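/- Let $\mathbb F$ be a field of characteristic $p>3$, let $n\ge 3$, and let $\underline t=(t_1,\dots,t_n)$ be positive integers. Let $\mathcal O(n,n)=\mathcal O(n)\otimes\Lambda(n)$ be the associative superalgebra over $\mathbb F$ with basis $\{x^{(\alpha)}x^u\}$, where $\mathcal O(n)$ is the divided power algebra with basis $x^{(\alpha)}$, $\alpha\in\mathbb N_0^n$ (so $x^{(\alpha)}x^{(\beta)}=\prod_i\binom{\alpha_i+\beta_i}{\alpha_i}\,x^{(\alpha+\beta)}$), and $\Lambda(n)$ is the exterior algebra in $x_{n+1},\dots,x_{2n}$ with basis $x^u=x_{i_1}\cdots x_{i_k}$, $u=\{i_1<\dots<i_k\}\subseteq\{n+1,\dots,2n\}$. Write $x_i=x^{(\varepsilon_i)}$ for $i\le n$. Let $\mathcal O(n,n;\underline t)$ be the subalgebra spanned by the $x^{(\alpha)}x^u$ with $\alpha_i\le p^{t_i}-1$ for all $i$; it is $\mathbb Z_2$-graded by the parity $\mathrm p(x^{(\alpha)}x^u)=|u| \bmod 2$ and $\mathbb Z$-graded by $\deg x^{(\alpha)}x^u=|\alpha|+|u|$. Put $\mu(r)=\bar 0$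 for $1\le r\le n$ and $\mu(r)=\bar 1$ for $n<r\le 2n$. Let $\partial_1,\dots,\partial_{2n}$ be the superderivations $\partial_r(x^{(\alpha)}x^u)=x^{(\alpha-\varepsilon_r)}x^u$ for $r\le n$ (which is $0$ if $\alpha_r=0$) and $\partial_r(x^{(\alpha)}x^u)=x^{(\alpha)}\,\partial x^u/\partial x_r$ for $r>n$. Let $W(n,n;\underline t)=\{\sum_{r=1}^{2n}f_r\partial_r : f_r\in\mathcal O(n,n;\underline t)\}$ be the generalized Witt Lie superalgebra, in which $f\partial_r$ has parity $\mathrm p(f)+\mu(r)$ and $\mathbb Z$-degree $\deg f-1$. For $1\le i\le 2n$ let $i'=i+n$ if $i\le n$ and $i'=i-n$ if $i>n$, and let $\mathrm{T_H}:\mathcal O(n,n;\underline t)\to W(n,n;\underline t)$ be the linear map with $$\mathrm{T_H}(a)=\sum_{i=1}^{2n}(-1)^{\mu(i)\mathrm p(a)}\,\partial_i(a)\,\partial_{i'}\qquad\text{for homogeneous } a .$$ Its image $HO(n,n;\underline t)$ is a $\mathbb Z$-graded Lie sub-superalgebra of $W(n,n;\underline t)$, the odd Hamiltonian superalgebra.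 Let $\mathcal W=\bigoplus_i\mathcal W_i$ and $\mathcal{HO}=\bigoplus_i\mathcal{HO}_i$ denote the even parts of $W(n,n;\underline t)$ and $HO(n,n;\underline t)$; these are $\mathbb Z$-graded Lie algebras, and $\mathcal{HO}_i=\mathcal{HO}\cap\mathcal W_i$. A derivation from $\mathcal{HO}$ into $\mathcal W$ is a linear map $D:\mathcal{HO}\to\mathcal W$ with $D([x,y])=[x,D(y)]-[y,D(x)]$ for all $x,y\in\mathcal{HO}$. For $d\in\mathbb Z$ let $\mathrm{Der}_d(\mathcal{HO},\mathcal W)$ be the space of those derivations with $D(\mathcal{HO}_i)\subseteq\mathcal W_{d+i}$ for all $i\in\mathbb Z$. Then for every integer $d\ge 0$ $$\mathrm{Der}_d(\mathcal{HO},\mathcal W)=\mathrm{ad}\,\mathcal W_d=\{\,(x\mapsto[E,x])|_{\mathcal{HO}} : E\in\mathcal W_d\,\};$$ in particular, every derivation of $\mathbb Z$-degree $d\ge 0$ from $\mathcal{HO}$ into $\mathcal W$ is inner. -/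

import Mathlib

noncomputable section

namespace OddHamiltonian

open Finset

/-! ### The superalgebra `𝒪(n,n)` -/

/-- The index `(α, u)` of the standard monomial `x^(α) x^u` of `𝒪(n,n)`: the exponent `α` of the
divided powers of `x_1, …, x_n`, and the set `u` of the odd variables that occur; the element
`k : Fin n` of `u` stands for the `k`-th odd variable, `x_{n+k}`. -/
abbrev Mono (n : ℕ) : Type := (Fin n → ℕ) × Finset (Fin n)

/-- The vector space `𝒪(n,n) = 𝒪(n) ⊗ Λ(n)` with basis the monomials `x^(α) x^u`. -/
abbrev DPS (F : Type*) [Field F] (n : ℕ) : Type _ := Mono n →₀ F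

/-- The index set `Y = Y₀ ∪ Y₁`: `Sum.inl i` is the `i`-th even index `i ∈ Y₀`, and `Sum.inr i` is
the odd index `i' = i + n ∈ Y₁`. The involution `r ↦ r'` of `Y` is `Sum.swap`. -/
abbrev Ind (n : ℕ) : Type := Fin n ⊕ Fin n

/-- The parity `μ` of an index: `0` on `Y₀` and `1` on `Y₁`. -/
def par {n : ℕ} : Ind n → ℕ
  | Sum.inl _ => 0
  | Sum.inr _ => 1

/-- The sign in `x_i x_j = ± x^{{i, j}}` for odd variables, `0` if `i = j`. -/
def pairSign {n : ℕ} (i j : Fin n) : ℤ := if i < j then 1 else if j < i then -1 else 0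

/-- The sign in `x^u x^v = ± x^{u ∪ v}`: it is `(-1)` to the number of pairs `(i, j) ∈ u × v` with
`j < i` if `u` and `v` are disjoint, and `0` otherwise. -/
def wedgeSign {n : ℕ} (u v : Finset (Fin n)) : ℤ := ∏ i ∈ u, ∏ j ∈ v, pairSign i j

/-- The structure constants of `𝒪(n,n)`:
`x^(α) x^u · x^(β) x^v = (∏ i, (α_i + β_i choose α_i)) (± 1 or 0) x^(α+β) x^{u ∪ v}`. -/
def mulCoeff {n : ℕ} (a b : Mono n) : ℤ :=
  ((∏ i, (a.1 i + b.1 i).choose (a.1 i) : ℕ) : ℤ) * wedgeSign a.2 b.2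

/-- The multiplication of the associative superalgebra `𝒪(n,n)`. -/
def mul (F : Type*) [Field F] (n : ℕ) : DPS F n →ₗ[F] DPS F n →ₗ[F] DPS F n :=
  Finsupp.linearCombination F fun a : Mono n =>
    Finsupp.linearCombination F fun b : Mono n =>
      (Finsupp.single (a.1 + b.1, a.2 ∪ b.2) ((mulCoeff a b : ℤ) : F) : DPS F n)

/-- The superderivations `∂_r`, `r ∈ Y`, of `𝒪(n,n)`:
`∂_i (x^(α) x^u) = x^(α - ε_i) x^u` for `i ∈ Y₀` (to be read as `0` if `α_i = 0`), and
`∂_k (x^(α) x^u) = x^(α) ∂x^u/∂x_k` for `k ∈ Y₁`. -/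
def pd (F : Type*) [Field F] (n : ℕ) : Ind n → (DPS F n →ₗ[F] DPS F n)
  | Sum.inl i => Finsupp.linearCombination F fun a : Mono n =>
      if a.1 i = 0 then 0 else (Finsupp.single (a.1 - Pi.single i 1, a.2) 1 : DPS F n)
  | Sum.inr k => Finsupp.linearCombination F fun a : Mono n =>
      if k ∈ a.2 then
        (Finsupp.single (a.1, a.2.erase k) ((-1) ^ #{j ∈ a.2 | j < k}) : DPS F n)
      else 0

/-- The homogeneous components of `𝒪(n,n)` for the `ℤ/2`-grading; `e` is read modulo `2`. -/
def parityPart (F : Type*) [Field F] (n : ℕ) (e : ℕ) : Submodule F (DPS F n) :=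
  Finsupp.supported F F {a : Mono n | #a.2 ≡ e [MOD 2]}

/-- The span of the monomials `x^(α) x^u` with `|α| + |u| = d`. -/
def degPart (F : Type*) [Field F] (n : ℕ) (d : ℤ) : Submodule F (DPS F n) :=
  Finsupp.supported F F {a : Mono n | ((∑ i, a.1 i + #a.2 : ℕ) : ℤ) = d}

/-- The truncated superalgebra `𝒪(n,n;t)`, spanned by the `x^(α) x^u` with
`α_i ≤ π_i = p^{t_i} - 1` for all `i`. -/
def trunc (F : Type*) [Field F] {n : ℕ} (p : ℕ) (t : Fin n → ℕ) : Submodule F (DPS F n) :=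
  Finsupp.supported F F {a : Mono n | ∀ i, a.1 i ≤ p ^ t i - 1}

/-! ### Vector fields -/

/-- The operator `∑_{r ∈ Y} f_r ∂_r` on `𝒪(n,n)` with coefficients `f_r ∈ 𝒪(n,n)`. -/
def vf (F : Type*) [Field F] (n : ℕ) : (Ind n → DPS F n) →ₗ[F] Module.End F (DPS F n) where
  toFun f := ∑ r, mul F n (f r) ∘ₗ pd F n r
  map_add' f g := by simp [LinearMap.add_comp, Finset.sum_add_distrib]
  map_smul' c f := by simp [LinearMap.smul_comp, Finset.smul_sum]

/-- The even part of `W(n,n;t)`: since `f ∂_r` has parity `p(f) + μ(r)`, it consists of the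
`∑ f_r ∂_r` with `f_r ∈ 𝒪(n,n;t)` of parity `μ(r)`. -/
def wittEvenSub (F : Type*) [Field F] {n : ℕ} (p : ℕ) (t : Fin n → ℕ) :
    Submodule F (Module.End F (DPS F n)) :=
  (Submodule.pi Set.univ fun r : Ind n => trunc F p t ⊓ parityPart F n (par r)).map (vf F n)

/-- The component `W(n,n;t)_d` of the `ℤ`-grading of `W(n,n;t)`, that is, the span of the `f ∂_r`
with `f ∈ 𝒪(n,n;t)` of degree `d + 1`. -/
def wittDeg (F : Type*) [Field F] {n : ℕ} (p : ℕ) (t : Fin n → ℕ) (d : ℤ) :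
    Submodule F (Module.End F (DPS F n)) :=
  (Submodule.pi Set.univ fun _ : Ind n => trunc F p t ⊓ degPart F n (d + 1)).map (vf F n)

/-- The linear map that multiplies a homogeneous element `a` by `(-1)^{μ(r) p(a)}`. -/
def twist (F : Type*) [Field F] (n : ℕ) (r : Ind n) : DPS F n →ₗ[F] DPS F n :=
  Finsupp.linearCombination F fun a : Mono n =>
    (Finsupp.single a ((-1) ^ (par r * #a.2)) : DPS F n)

/-- The map `T_H(a) = ∑_{i ∈ Y} (-1)^{μ(i) p(a)} ∂_i(a) ∂_{i'}`. -/
def TH (F : Type*) [Field F] (n : ℕ) : DPS F n →ₗ[F] Module.End F (DPS F n) where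
  toFun a := ∑ i : Ind n, mul F n (pd F n i (twist F n i a)) ∘ₗ pd F n i.swap
  map_add' f g := by simp [LinearMap.add_comp, Finset.sum_add_distrib]
  map_smul' c f := by simp [LinearMap.smul_comp, Finset.smul_sum]

/-- The odd Hamiltonian superalgebra `HO(n,n;t)`, the set of all `T_H(a)`, `a ∈ 𝒪(n,n;t)`. -/
def hoSub (F : Type*) [Field F] {n : ℕ} (p : ℕ) (t : Fin n → ℕ) :
    Submodule F (Module.End F (DPS F n)) :=
  (trunc F p t).map (TH F n)

/-! ### Closure under the commutator -/

section Combinatorics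

variable {n : ℕ}

theorem pairSign_self (i : Fin n) : pairSign i i = 0 := by simp [pairSign]

theorem pairSign_swap (i j : Fin n) : pairSign i j = -pairSign j i := by
  rcases lt_trichotomy i j with h | h | h
  · simp [pairSign, h, h.not_gt]
  · simp [pairSign, h]
  · simp [pairSign, h, h.not_gt]

theorem pairSign_sq {i j : Fin n} (h : i ≠ j) : pairSign i j * pairSign i j = 1 := by
  rcases lt_or_gt_of_ne h with h | h
  · simp [pairSign, h]
  · simp [pairSign, h, h.not_gt]

theorem wedgeSign_eq_zero {u v : Finset (Fin n)} {i : Fin n} (hu : i ∈ u) (hv : i ∈ v) :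
    wedgeSign u v = 0 :=
  Finset.prod_eq_zero hu (Finset.prod_eq_zero hv (pairSign_self i))

theorem wedgeSign_union_left {u v w : Finset (Fin n)} (h : Disjoint u v) :
    wedgeSign (u ∪ v) w = wedgeSign u w * wedgeSign v w := Finset.prod_union h

theorem wedgeSign_union_right {u v w : Finset (Fin n)} (h : Disjoint v w) :
    wedgeSign u (v ∪ w) = wedgeSign u v * wedgeSign u w := by
  simp only [wedgeSign, Finset.prod_union h, Finset.prod_mul_distrib]

theorem wedgeSign_swap (u v : Finset (Fin n)) :
    wedgeSign u v = (-1) ^ (#u * #v) * wedgeSign v u := by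
  have h : ∀ j, (∏ i ∈ u, pairSign i j) = (-1) ^ #u * ∏ i ∈ u, pairSign j i := fun j => by
    rw [← Finset.prod_const, ← Finset.prod_mul_distrib]
    exact Finset.prod_congr rfl fun i _ => by rw [pairSign_swap]; ring
  unfold wedgeSign
  rw [Finset.prod_comm]
  simp only [h, Finset.prod_mul_distrib, Finset.prod_const, ← pow_mul]

theorem wedgeSign_sq {k : Fin n} {u : Finset (Fin n)} (h : k ∉ u) :
    wedgeSign {k} u * wedgeSign {k} u = 1 := by
  simp only [wedgeSign, Finset.prod_singleton, ← Finset.prod_mul_distrib]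
  exact Finset.prod_eq_one fun j hj => pairSign_sq (by rintro rfl; exact h hj)

theorem wedgeSign_assoc (u v w : Finset (Fin n)) :
    wedgeSign u v * wedgeSign (u ∪ v) w = wedgeSign v w * wedgeSign u (v ∪ w) := by
  by_cases h : Disjoint u v
  · by_cases h' : Disjoint v w
    · rw [wedgeSign_union_left h, wedgeSign_union_right h']; ring
    · obtain ⟨i, hi, hi'⟩ := Finset.not_disjoint_iff.1 h'
      rw [wedgeSign_eq_zero hi hi', wedgeSign_eq_zero (Finset.mem_union_right u hi) hi']; ring
  · obtain ⟨i, hi, hi'⟩ := Finset.not_disjoint_iff.1 h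
    rw [wedgeSign_eq_zero hi hi', wedgeSign_eq_zero hi (Finset.mem_union_left w hi')]; ring

theorem diffSign (k : Fin n) (u : Finset (Fin n)) :
    ((-1) ^ #{j ∈ u | j < k} : ℤ) = wedgeSign {k} (u.erase k) := by
  have h : ({j ∈ u | j < k} : Finset (Fin n)) = {j ∈ u.erase k | j < k} := by
    ext j
    simp only [Finset.mem_filter, Finset.mem_erase]
    exact ⟨fun h => ⟨⟨h.2.ne, h.1⟩, h.2⟩, fun h => ⟨h.1.2, h.2⟩⟩
  rw [h, ← Finset.prod_const, Finset.prod_filter, wedgeSign, Finset.prod_singleton]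
  refine Finset.prod_congr rfl fun j hj => ?_
  rcases lt_or_gt_of_ne (Finset.ne_of_mem_erase hj) with h | h
  · simp [pairSign, h, h.not_gt]
  · simp [pairSign, h, h.not_gt]

theorem choose_assoc (a b c : ℕ) :
    (a + b).choose a * (a + b + c).choose (a + b) =
      (b + c).choose b * (a + (b + c)).choose a := by
  have h := Nat.choose_mul (n := a + b + c) (k := a + b) (s := a) (by omega)
  rw [show a + b + c - a = b + c by omega, show a + b - a = b by omega] at h
  rw [mul_comm, h, mul_comm, add_assoc]

theorem mulCoeff_assoc (a b c : Mono n) :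
    mulCoeff a b * mulCoeff (a.1 + b.1, a.2 ∪ b.2) c =
      mulCoeff b c * mulCoeff a (b.1 + c.1, b.2 ∪ c.2) := by
  have h := wedgeSign_assoc a.2 b.2 c.2
  have h2 : (∏ i, (a.1 i + b.1 i).choose (a.1 i)) *
      (∏ i, (a.1 i + b.1 i + c.1 i).choose (a.1 i + b.1 i)) =
      (∏ i, (b.1 i + c.1 i).choose (b.1 i)) *
      (∏ i, (a.1 i + (b.1 i + c.1 i)).choose (a.1 i)) := by
    rw [← Finset.prod_mul_distrib, ← Finset.prod_mul_distrib]
    exact Finset.prod_congr rfl fun i _ => choose_assoc _ _ _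
  have h3 : ((∏ i, (a.1 i + b.1 i).choose (a.1 i) : ℕ) : ℤ) *
      ((∏ i, (a.1 i + b.1 i + c.1 i).choose (a.1 i + b.1 i) : ℕ) : ℤ) =
      ((∏ i, (b.1 i + c.1 i).choose (b.1 i) : ℕ) : ℤ) *
      ((∏ i, (a.1 i + (b.1 i + c.1 i)).choose (a.1 i) : ℕ) : ℤ) := by exact_mod_cast h2
  simp only [mulCoeff, Pi.add_apply]
  linear_combination (wedgeSign a.2 b.2 * wedgeSign (a.2 ∪ b.2) c.2) * h3 +
    ((∏ i, (b.1 i + c.1 i).choose (b.1 i) : ℕ) : ℤ) *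
      ((∏ i, (a.1 i + (b.1 i + c.1 i)).choose (a.1 i) : ℕ) : ℤ) * h

theorem choose_eq_zero_of_carry {F : Type*} [Field F] (p : ℕ) [Fact p.Prime] [CharP F p]
    {k a b : ℕ} (ha : a < p ^ k) (hb : b < p ^ k) (hab : p ^ k ≤ a + b) :
    (((a + b).choose a : ℕ) : F) = 0 := by
  obtain ⟨c, hc⟩ := Nat.exists_eq_add_of_le hab
  have h : ((1 + Polynomial.X : Polynomial F) ^ (a + b)) =
      (1 + Polynomial.X ^ p ^ k) * (1 + Polynomial.X) ^ c := by
    rw [hc, pow_add, add_pow_char_pow, one_pow]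
  have h2 := congrArg (fun q => q.coeff a) h
  simp only [Polynomial.coeff_one_add_X_pow, add_mul, one_mul, Polynomial.coeff_add,
    Polynomial.coeff_X_pow_mul'] at h2
  rw [h2, if_neg (by omega), Nat.choose_eq_zero_of_lt (by omega)]
  simp

end Combinatorics

section Algebra

variable {F : Type*} [Field F] {n : ℕ}

theorem mul_single (a b : Mono n) (c d : F) :
    mul F n (Finsupp.single a c) (Finsupp.single b d) =
      Finsupp.single (a.1 + b.1, a.2 ∪ b.2) (c * d * ((mulCoeff a b : ℤ) : F)) := by
  simp only [mul, Finsupp.linearCombination_single, LinearMap.smul_apply, Finsupp.smul_single,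
    smul_eq_mul, mul_assoc]

theorem mul_assoc' (f g h : DPS F n) :
    mul F n (mul F n f g) h = mul F n f (mul F n g h) := by
  induction f using Finsupp.induction_linear with
  | zero => simp
  | add f₁ f₂ h₁ h₂ => simp only [map_add, LinearMap.add_apply, h₁, h₂]
  | single a c =>
    induction g using Finsupp.induction_linear with
    | zero => simp
    | add f₁ f₂ h₁ h₂ => simp only [map_add, LinearMap.add_apply, h₁, h₂]
    | single b d =>
      induction h using Finsupp.induction_linear with
      | zero => simp
      | add f₁ f₂ h₁ h₂ => simp only [map_add, h₁, h₂]
      | single e k =>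
        rw [mul_single, mul_single, mul_single, mul_single]
        have := congrArg (Int.cast : ℤ → F) (mulCoeff_assoc a b e)
        push_cast at this
        simp only [add_assoc, Finset.union_assoc]
        congr 1
        linear_combination (c * d * k) * this

theorem mem_parity_induction {e : ℕ} {P : DPS F n → Prop} {f : DPS F n}
    (hf : f ∈ parityPart F n e) (h0 : P 0) (hadd : ∀ f g, P f → P g → P (f + g))
    (hs : ∀ (a : Mono n) (c : F), #a.2 ≡ e [MOD 2] → P (Finsupp.single a c)) : P f := by
  rw [← Finsupp.sum_single f]
  refine Finset.sum_induction _ P hadd h0 fun a ha => hs a _ ?_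
  exact (Finsupp.mem_supported F f).1 hf (by simpa using ha)

theorem neg_one_pow_congr {a b : ℕ} (h : a ≡ b [MOD 2]) : ((-1 : F)) ^ a = (-1) ^ b := by
  rw [neg_one_pow_eq_pow_mod_two, neg_one_pow_eq_pow_mod_two (n := b)]
  rw [show a % 2 = b % 2 from h]

theorem mul_comm' {e e' : ℕ} {f g : DPS F n} (hf : f ∈ parityPart F n e)
    (hg : g ∈ parityPart F n e') : mul F n f g = (-1 : F) ^ (e * e') • mul F n g f := by
  refine mem_parity_induction
    (P := fun f => mul F n f g = (-1 : F) ^ (e * e') • mul F n g f) hf (by simp) (fun f₁ f₂ h₁ h₂ => ?_) fun a c ha => ?_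
  · simp only [map_add, LinearMap.add_apply, h₁, h₂, smul_add]
  refine mem_parity_induction
    (P := fun g => mul F n (Finsupp.single a c) g =
      (-1 : F) ^ (e * e') • mul F n g (Finsupp.single a c)) hg (by simp) (fun f₁ f₂ h₁ h₂ => ?_) fun b d hb => ?_
  · simp only [map_add, LinearMap.add_apply, h₁, h₂, smul_add]
  rw [mul_single, mul_single, add_comm b.1, Finset.union_comm b.2, Finsupp.smul_single,
    smul_eq_mul, ← neg_one_pow_congr (F := F) (ha.mul hb)]
  congr 1
  have h1 : mulCoeff a b = (-1) ^ (#a.2 * #b.2) * mulCoeff b a := by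
    have : ∀ i, (a.1 i + b.1 i).choose (a.1 i) = (b.1 i + a.1 i).choose (b.1 i) := fun i => by
      rw [add_comm (b.1 i), Nat.choose_symm_add]
    simp only [mulCoeff, this]
    rw [wedgeSign_swap]; ring
  rw [h1]; push_cast; ring

theorem pd_even_single (i : Fin n) (a : Mono n) (c : F) :
    pd F n (Sum.inl i) (Finsupp.single a c) =
      if a.1 i = 0 then 0 else Finsupp.single (a.1 - Pi.single i 1, a.2) c := by
  simp only [pd, Finsupp.linearCombination_single]
  split_ifs <;> simp

theorem pd_odd_single (k : Fin n) (a : Mono n) (c : F) :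
    pd F n (Sum.inr k) (Finsupp.single a c) =
      if k ∈ a.2 then
        Finsupp.single (a.1, a.2.erase k) (c * ((wedgeSign {k} (a.2.erase k) : ℤ) : F)) else 0 := by
  simp only [pd, Finsupp.linearCombination_single, ← diffSign]
  split_ifs <;> simp

theorem pd_even_mul (i : Fin n) (f g : DPS F n) :
    pd F n (Sum.inl i) (mul F n f g) =
      mul F n (pd F n (Sum.inl i) f) g + mul F n f (pd F n (Sum.inl i) g) := by
  induction f using Finsupp.induction_linear with
  | zero => simp
  | add f₁ f₂ h₁ h₂ => simp only [map_add, LinearMap.add_apply, h₁, h₂]; abel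
  | single a c =>
    induction g using Finsupp.induction_linear with
    | zero => simp
    | add f₁ f₂ h₁ h₂ => simp only [map_add, h₁, h₂]; abel
    | single b d =>
      rw [mul_single, pd_even_single, pd_even_single, pd_even_single]
      have key : ∀ (x y : Fin n → ℕ), (∏ j, (x j + y j).choose (x j)) =
          (x i + y i).choose (x i) * ∏ j ∈ univ.erase i, (x j + y j).choose (x j) :=
        fun x y => (Finset.mul_prod_erase univ (fun j => (x j + y j).choose (x j))
          (Finset.mem_univ i)).symm
      have hL : ∀ x y : Fin n → ℕ, (∏ j ∈ univ.erase i,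
          ((x - Pi.single i 1 : Fin n → ℕ) j + y j).choose ((x - Pi.single i 1 : Fin n → ℕ) j)) =
          ∏ j ∈ univ.erase i, (x j + y j).choose (x j) := fun x y =>
        Finset.prod_congr rfl fun j hj => by
          simp [Finset.ne_of_mem_erase hj]
      have hR : ∀ x y : Fin n → ℕ, (∏ j ∈ univ.erase i,
          (x j + (y - Pi.single i 1 : Fin n → ℕ) j).choose (x j)) =
          ∏ j ∈ univ.erase i, (x j + y j).choose (x j) := fun x y =>
        Finset.prod_congr rfl fun j hj => by
          simp [Finset.ne_of_mem_erase hj]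
      have eL : a.1 i ≠ 0 → a.1 - Pi.single i 1 + b.1 = a.1 + b.1 - Pi.single i 1 := fun h => by
        funext j
        rcases eq_or_ne j i with rfl | hj
        · simp; omega
        · simp [hj]
      have eR : b.1 i ≠ 0 → a.1 + (b.1 - Pi.single i 1) = a.1 + b.1 - Pi.single i 1 := fun h => by
        funext j
        rcases eq_or_ne j i with rfl | hj
        · simp; omega
        · simp [hj]
      rcases Nat.eq_zero_or_pos (a.1 i) with ha | ha <;>
        rcases Nat.eq_zero_or_pos (b.1 i) with hb | hb
      · simp [ha, hb]
      · simp only [Pi.add_apply, ha, hb.ne', if_true, if_false, zero_add, map_zero,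
          LinearMap.zero_apply, mul_single, eR hb.ne', mulCoeff, key, hR]
        congr 1
        simp
      · simp only [Pi.add_apply, ha.ne', hb, if_true, if_false, add_zero, map_zero,
          mul_single, eL ha.ne', mulCoeff, key, hL]
        congr 1
        simp
      · have : a.1 i + b.1 i ≠ 0 := by omega
        simp only [Pi.add_apply, ha.ne', hb.ne', this, if_false, mul_single, eL ha.ne',
          eR hb.ne', mulCoeff, key, hL, hR, ← Finsupp.single_add]
        congr 1
        obtain ⟨x, hx⟩ := Nat.exists_eq_succ_of_ne_zero ha.ne'
        obtain ⟨y, hy⟩ := Nat.exists_eq_succ_of_ne_zero hb.ne'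
        have hp : (a.1 i + b.1 i).choose (a.1 i) =
            ((a.1 - Pi.single i 1 : Fin n → ℕ) i + b.1 i).choose
              ((a.1 - Pi.single i 1 : Fin n → ℕ) i) +
            (a.1 i + (b.1 - Pi.single i 1 : Fin n → ℕ) i).choose (a.1 i) := by
          simp only [Pi.sub_apply, Pi.single_eq_same, hx, hy, Nat.succ_eq_add_one,
            Nat.add_sub_cancel]
          rw [show x + 1 + (y + 1) = (x + y + 1) + 1 by ring, Nat.choose_succ_succ]
          congr 2
          ring
        rw [hp]; push_cast; ring

theorem oddLeibniz (k : Fin n) (u v : Finset (Fin n)) :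
    (if k ∈ u ∪ v then
      (Finsupp.single ((u ∪ v).erase k) (wedgeSign u v * wedgeSign {k} ((u ∪ v).erase k)) :
        Finset (Fin n) →₀ ℤ) else 0) =
    (if k ∈ u then Finsupp.single (u.erase k ∪ v)
      (wedgeSign {k} (u.erase k) * wedgeSign (u.erase k) v) else 0) +
    (if k ∈ v then Finsupp.single (u ∪ v.erase k)
      ((-1) ^ #u * (wedgeSign {k} (v.erase k) * wedgeSign u (v.erase k))) else 0) := by
  have hins : ∀ {w : Finset (Fin n)}, k ∈ w → w = {k} ∪ w.erase k := fun h => by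
    rw [← Finset.insert_eq, Finset.insert_erase h]
  have hd : ∀ w : Finset (Fin n), Disjoint {k} (w.erase k) := fun w => by simp
  have hk : ∀ w : Finset (Fin n), k ∉ w.erase k := fun w => by simp
  by_cases hu : k ∈ u <;> by_cases hv : k ∈ v
  · obtain ⟨u', hu', rfl⟩ : ∃ u', k ∉ u' ∧ u = {k} ∪ u' := ⟨_, hk u, hins hu⟩
    obtain ⟨v', hv', rfl⟩ : ∃ v', k ∉ v' ∧ v = {k} ∪ v' := ⟨_, hk v, hins hv⟩
    have du : Disjoint {k} u' := by simpa using hu'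
    have dv : Disjoint {k} v' := by simpa using hv'
    have e1 : ({k} ∪ u').erase k = u' := by rw [← Finset.insert_eq, Finset.erase_insert hu']
    have e2 : ({k} ∪ v').erase k = v' := by rw [← Finset.insert_eq, Finset.erase_insert hv']
    have e3 : u' ∪ ({k} ∪ v') = {k} ∪ u' ∪ v' := by
      rw [← Finset.union_assoc, Finset.union_comm u']
    have e4 : #({k} ∪ u') = #u' + 1 := by rw [← Finset.insert_eq, Finset.card_insert_of_notMem hu']
    rw [if_pos hu, if_pos hv, if_pos (Finset.mem_union_left _ hu), wedgeSign_eq_zero hu hv,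
      e1, e2, e3, e4, ← Finsupp.single_add, wedgeSign_union_left du, wedgeSign_union_right dv,
      wedgeSign_swap u' {k}]
    have h1 := wedgeSign_sq hu'
    have h2 := wedgeSign_sq hv'
    simp only [zero_mul, Finsupp.single_zero, Finset.card_singleton, mul_one]
    rw [eq_comm, Finsupp.single_eq_zero, pow_succ]
    linear_combination ((-1) ^ #u' * wedgeSign u' v') * (h1 - h2)
  · obtain ⟨u', hu', rfl⟩ : ∃ u', k ∉ u' ∧ u = {k} ∪ u' := ⟨_, hk u, hins hu⟩
    have du : Disjoint {k} u' := by simpa using hu'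
    have e1 : ({k} ∪ u').erase k = u' := by rw [← Finset.insert_eq, Finset.erase_insert hu']
    have e2 : ({k} ∪ u' ∪ v).erase k = u' ∪ v := by
      rw [Finset.union_assoc, ← Finset.insert_eq, Finset.erase_insert (by simp [hu', hv])]
    rw [if_pos hu, if_neg hv, if_pos (Finset.mem_union_left _ hu), e1, e2, add_zero]
    congr 1
    by_cases h : Disjoint u' v
    · rw [wedgeSign_union_left du, wedgeSign_union_right h]
      linear_combination (wedgeSign {k} u' * wedgeSign u' v) * wedgeSign_sq hv
    · obtain ⟨i, hi, hi'⟩ := Finset.not_disjoint_iff.1 h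
      rw [wedgeSign_eq_zero hi hi', wedgeSign_eq_zero (Finset.mem_union_right _ hi) hi']; ring
  · obtain ⟨v', hv', rfl⟩ : ∃ v', k ∉ v' ∧ v = {k} ∪ v' := ⟨_, hk v, hins hv⟩
    have dv : Disjoint {k} v' := by simpa using hv'
    have e1 : ({k} ∪ v').erase k = v' := by rw [← Finset.insert_eq, Finset.erase_insert hv']
    have e2 : (u ∪ ({k} ∪ v')).erase k = u ∪ v' := by
      rw [Finset.union_left_comm, ← Finset.insert_eq, Finset.erase_insert (by simp [hu, hv'])]
    rw [if_neg hu, if_pos hv, if_pos (Finset.mem_union_right _ hv), e1, e2, zero_add]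
    congr 1
    by_cases h : Disjoint u v'
    · rw [wedgeSign_union_right dv, wedgeSign_union_right h, wedgeSign_swap u {k}]
      simp only [Finset.card_singleton, mul_one]
      linear_combination ((-1) ^ #u * wedgeSign {k} v' * wedgeSign u v') * wedgeSign_sq hu
    · obtain ⟨i, hi, hi'⟩ := Finset.not_disjoint_iff.1 h
      rw [wedgeSign_eq_zero hi hi', wedgeSign_eq_zero hi (Finset.mem_union_right _ hi')]; ring
  · rw [if_neg hu, if_neg hv, if_neg (by simp [hu, hv]), add_zero]

theorem pd_odd_mul_single (k : Fin n) (a b : Mono n) (c d : F) :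
    pd F n (Sum.inr k) (mul F n (Finsupp.single a c) (Finsupp.single b d)) =
      mul F n (pd F n (Sum.inr k) (Finsupp.single a c)) (Finsupp.single b d) +
      (-1 : F) ^ #a.2 •
        mul F n (Finsupp.single a c) (pd F n (Sum.inr k) (Finsupp.single b d)) := by
  let q : F := c * d * ((∏ i, (a.1 i + b.1 i).choose (a.1 i) : ℕ) : F)
  let T : (Finset (Fin n) →₀ ℤ) →+ DPS F n := Finsupp.liftAddHom fun w =>
    (Finsupp.singleAddHom (a.1 + b.1, w)).comp
      ((AddMonoidHom.mulLeft q).comp (Int.castAddHom F))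
  have hT : ∀ w m, T (Finsupp.single w m) = Finsupp.single (a.1 + b.1, w) (q * (m : F)) :=
    fun w m => by simp [T]
  have h := congrArg T (oddLeibniz k a.2 b.2)
  rw [map_add] at h
  rw [mul_single, pd_odd_single, pd_odd_single, pd_odd_single]
  simp only [apply_ite T, hT, map_zero] at h
  convert h using 1
  · refine if_congr Iff.rfl ?_ rfl
    congr 1
    simp only [q, mulCoeff]; push_cast; ring
  · congr 1
    · by_cases hk : k ∈ a.2
      · simp only [if_pos hk, mul_single]
        congr 1
        simp only [q, mulCoeff]; push_cast; ring
      · simp [hk]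
    · by_cases hk : k ∈ b.2
      · simp only [if_pos hk, mul_single, Finsupp.smul_single, smul_eq_mul]
        congr 1
        simp only [q, mulCoeff]; push_cast; ring
      · simp [hk]

theorem pd_mul (r : Ind n) {e : ℕ} {f : DPS F n} (hf : f ∈ parityPart F n e) (g : DPS F n) :
    pd F n r (mul F n f g) =
      mul F n (pd F n r f) g + (-1 : F) ^ (par r * e) • mul F n f (pd F n r g) := by
  rcases r with i | k
  · simp [par, pd_even_mul]
  · refine mem_parity_induction
      (P := fun f => pd F n (Sum.inr k) (mul F n f g) = mul F n (pd F n (Sum.inr k) f) g +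
        (-1 : F) ^ (par (Sum.inr k : Ind n) * e) • mul F n f (pd F n (Sum.inr k) g)) hf (by simp)
      (fun f₁ f₂ h₁ h₂ => ?_) fun a c ha => ?_
    · simp only [map_add, LinearMap.add_apply, h₁, h₂, smul_add]; abel
    · induction g using Finsupp.induction_linear with
      | zero => simp
      | add f₁ f₂ h₁ h₂ => simp only [map_add, h₁, h₂, smul_add]; abel
      | single b d =>
        rw [pd_odd_mul_single, neg_one_pow_congr (F := F) ha]
        simp only [par, one_mul]

theorem pd_comm (r s : Ind n) (f : DPS F n) :
    pd F n r (pd F n s f) = (-1 : F) ^ (par r * par s) • pd F n s (pd F n r f) := by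
  induction f using Finsupp.induction_linear with
  | zero => simp
  | add f₁ f₂ h₁ h₂ => simp only [map_add, h₁, h₂, smul_add]
  | single a c =>
    rcases r with i | k <;> rcases s with j | l
    · rcases eq_or_ne i j with rfl | hij
      · simp [par]
      · simp only [pd_even_single, par, apply_ite (pd F n (Sum.inl i)),
          apply_ite (pd F n (Sum.inl j)), map_zero, Pi.sub_apply, Pi.single_apply, hij, hij.symm,
          if_false, Nat.sub_zero, tsub_right_comm]
        split_ifs <;> simp
    · simp only [pd_even_single, pd_odd_single, par, apply_ite (pd F n (Sum.inl i)),
        apply_ite (pd F n (Sum.inr l)), map_zero]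
      split_ifs <;> simp
    · simp only [pd_even_single, pd_odd_single, par, apply_ite (pd F n (Sum.inl j)),
        apply_ite (pd F n (Sum.inr k)), map_zero]
      split_ifs <;> simp
    · rcases eq_or_ne k l with rfl | hkl
      · have : pd F n (Sum.inr k) (pd F n (Sum.inr k) (Finsupp.single a c)) = 0 := by
          rw [pd_odd_single]
          split_ifs
          · rw [pd_odd_single]; simp
          · simp
        simp [this]
      · have hs : ∀ {x y : Fin n} {u : Finset (Fin n)}, x ≠ y → y ∈ u →
            wedgeSign {x} (u.erase x) = pairSign x y * wedgeSign {x} ((u.erase x).erase y) :=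
          fun {x y u} hxy hy => by
            simp only [wedgeSign, Finset.prod_singleton]
            exact (Finset.mul_prod_erase _ _ (Finset.mem_erase.2 ⟨hxy.symm, hy⟩)).symm
        by_cases hk : k ∈ a.2 <;> by_cases hl : l ∈ a.2
        · have hk' : k ∈ a.2.erase l := Finset.mem_erase.2 ⟨hkl, hk⟩
          have hl' : l ∈ a.2.erase k := Finset.mem_erase.2 ⟨hkl.symm, hl⟩
          simp only [pd_odd_single, if_pos hk, if_pos hl, if_pos hk', if_pos hl',
            Finsupp.smul_single, smul_eq_mul, Finset.erase_right_comm (a := l) (b := k)]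
          congr 1
          rw [hs hkl hl, hs hkl.symm hk, Finset.erase_right_comm (a := l) (b := k),
            pairSign_swap l k]
          simp only [par]
          push_cast; ring
        · simp only [pd_odd_single, if_pos hk, Finset.mem_erase, hl, and_false,
            if_false, map_zero, smul_zero]
        · simp only [pd_odd_single, if_pos hl, Finset.mem_erase, hk, and_false,
            if_false, map_zero, smul_zero]
        · simp only [pd_odd_single, if_neg hl, if_neg hk, map_zero, smul_zero]

theorem parityPart_congr {e e' : ℕ} (h : e ≡ e' [MOD 2]) {f : DPS F n}
    (hf : f ∈ parityPart F n e) : f ∈ parityPart F n e' :=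
  Finsupp.supported_mono (fun _ ha => Nat.ModEq.trans ha h) hf

theorem single_mem_parityPart {e : ℕ} {a : Mono n} (c : F) (h : #a.2 ≡ e [MOD 2]) :
    Finsupp.single a c ∈ parityPart F n e := Finsupp.single_mem_supported F c h

theorem mul_mem_parityPart {e e' : ℕ} {f g : DPS F n} (hf : f ∈ parityPart F n e)
    (hg : g ∈ parityPart F n e') : mul F n f g ∈ parityPart F n (e + e') := by
  refine mem_parity_induction (P := fun f => mul F n f g ∈ parityPart F n (e + e')) hf (by simp)
    (fun f₁ f₂ h₁ h₂ => ?_) fun a c ha => ?_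
  · simpa only [map_add, LinearMap.add_apply] using add_mem h₁ h₂
  refine mem_parity_induction
    (P := fun g => mul F n (Finsupp.single a c) g ∈ parityPart F n (e + e')) hg (by simp)
    (fun f₁ f₂ h₁ h₂ => ?_) fun b d hb => ?_
  · simpa only [map_add] using add_mem h₁ h₂
  rw [mul_single]
  by_cases h : Disjoint a.2 b.2
  · refine single_mem_parityPart _ ?_
    rw [Finset.card_union_of_disjoint h]
    exact ha.add hb
  · obtain ⟨i, hi, hi'⟩ := Finset.not_disjoint_iff.1 h
    simp [mulCoeff, wedgeSign_eq_zero hi hi']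

theorem pd_mem_parityPart (r : Ind n) {e : ℕ} {f : DPS F n} (hf : f ∈ parityPart F n e) :
    pd F n r f ∈ parityPart F n (e + par r) := by
  refine mem_parity_induction (P := fun f => pd F n r f ∈ parityPart F n (e + par r)) hf (by simp)
    (fun f₁ f₂ h₁ h₂ => ?_) fun a c ha => ?_
  · simpa only [map_add] using add_mem h₁ h₂
  rcases r with i | k
  · rw [pd_even_single]
    split_ifs
    · simp
    · exact single_mem_parityPart _ ha
  · rw [pd_odd_single]
    split_ifs with h
    · refine single_mem_parityPart _ ?_
      have h1 : #(a.2.erase k) + 1 = #a.2 := Finset.card_erase_add_one h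
      have h2 : #a.2 % 2 = e % 2 := ha
      change #(a.2.erase k) % 2 = (e + 1) % 2
      omega
    · simp

theorem mem_trunc_induction {p : ℕ} {t : Fin n → ℕ} {P : DPS F n → Prop} {f : DPS F n}
    (hf : f ∈ trunc F p t) (h0 : P 0) (hadd : ∀ f g, P f → P g → P (f + g))
    (hs : ∀ (a : Mono n) (c : F), (∀ i, a.1 i ≤ p ^ t i - 1) → P (Finsupp.single a c)) : P f := by
  rw [← Finsupp.sum_single f]
  refine Finset.sum_induction _ P hadd h0 fun a ha => hs a _ ?_
  exact (Finsupp.mem_supported F f).1 hf (by simpa using ha)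

theorem mul_mem_trunc {p : ℕ} [Fact p.Prime] [CharP F p] {t : Fin n → ℕ} {f g : DPS F n}
    (hf : f ∈ trunc F p t) (hg : g ∈ trunc F p t) : mul F n f g ∈ trunc F p t := by
  refine mem_trunc_induction (P := fun f => mul F n f g ∈ trunc F p t) hf (by simp)
    (fun f₁ f₂ h₁ h₂ => ?_) fun a c ha => ?_
  · simpa only [map_add, LinearMap.add_apply] using add_mem h₁ h₂
  refine mem_trunc_induction
    (P := fun g => mul F n (Finsupp.single a c) g ∈ trunc F p t) hg (by simp)
    (fun f₁ f₂ h₁ h₂ => ?_) fun b d hb => ?_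
  · simpa only [map_add] using add_mem h₁ h₂
  rw [mul_single]
  by_cases h : ∀ i, a.1 i + b.1 i ≤ p ^ t i - 1
  · exact Finsupp.single_mem_supported F _ h
  · push Not at h
    obtain ⟨i, hi⟩ := h
    have hp : 0 < p ^ t i := pow_pos (Fact.out : p.Prime).pos _
    have h1 := ha i
    have h2 := hb i
    have h0 : (((a.1 i + b.1 i).choose (a.1 i) : ℕ) : F) = 0 :=
      choose_eq_zero_of_carry p (k := t i) (by omega) (by omega) (by omega)
    have : ((mulCoeff a b : ℤ) : F) = 0 := by
      simp only [mulCoeff]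
      push_cast
      rw [Finset.prod_eq_zero (Finset.mem_univ i) h0, zero_mul]
    simp [this]

theorem pd_mem_trunc {p : ℕ} {t : Fin n → ℕ} (r : Ind n) {f : DPS F n}
    (hf : f ∈ trunc F p t) : pd F n r f ∈ trunc F p t := by
  refine mem_trunc_induction (P := fun f => pd F n r f ∈ trunc F p t) hf (by simp)
    (fun f₁ f₂ h₁ h₂ => ?_) fun a c ha => ?_
  · simpa only [map_add] using add_mem h₁ h₂
  rcases r with i | k
  · rw [pd_even_single]
    split_ifs
    · simp
    · exact Finsupp.single_mem_supported F _ fun j => (Nat.sub_le _ _).trans (ha j)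
  · rw [pd_odd_single]
    split_ifs with h
    · exact Finsupp.single_mem_supported F _ ha
    · simp

theorem vf_apply (f : Ind n → DPS F n) (a : DPS F n) :
    vf F n f a = ∑ r, mul F n (f r) (pd F n r a) := by
  simp [vf]

theorem vf_mem_trunc {p : ℕ} [Fact p.Prime] [CharP F p] {t : Fin n → ℕ} {f : Ind n → DPS F n}
    (hf : ∀ r, f r ∈ trunc F p t) {a : DPS F n} (ha : a ∈ trunc F p t) :
    vf F n f a ∈ trunc F p t := by
  rw [vf_apply]
  exact Submodule.sum_mem _ fun r _ => mul_mem_trunc (hf r) (pd_mem_trunc r ha)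

theorem vf_mem_parityPart {f : Ind n → DPS F n} (hf : ∀ r, f r ∈ parityPart F n (par r)) {e : ℕ}
    {a : DPS F n} (ha : a ∈ parityPart F n e) : vf F n f a ∈ parityPart F n e := by
  rw [vf_apply]
  refine Submodule.sum_mem _ fun r _ => parityPart_congr ?_
    (mul_mem_parityPart (hf r) (pd_mem_parityPart r ha))
  change (par r + (e + par r)) % 2 = e % 2
  omega

theorem vf_mul {f : Ind n → DPS F n} (hf : ∀ r, f r ∈ parityPart F n (par r)) {e : ℕ}
    {a : DPS F n} (ha : a ∈ parityPart F n e) (b : DPS F n) :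
    vf F n f (mul F n a b) = mul F n (vf F n f a) b + mul F n a (vf F n f b) := by
  simp only [vf_apply, map_sum, LinearMap.sum_apply]
  rw [← Finset.sum_add_distrib]
  refine Finset.sum_congr rfl fun r _ => ?_
  rw [pd_mul r ha, map_add, map_smul, mul_assoc', ← mul_assoc' (f r) a, mul_comm' (hf r) ha,
    map_smul, LinearMap.smul_apply, smul_smul, ← pow_add, mul_assoc']
  congr 1
  rw [← two_mul, pow_mul]
  simp

theorem vf_lie {f g : Ind n → DPS F n} (hf : ∀ r, f r ∈ parityPart F n (par r))
    (hg : ∀ r, g r ∈ parityPart F n (par r)) :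
    vf F n f * vf F n g - vf F n g * vf F n f = vf F n fun s => vf F n f (g s) - vf F n g (f s) := by
  refine LinearMap.ext fun a => ?_
  have key : ∀ {f g : Ind n → DPS F n}, (∀ r, f r ∈ parityPart F n (par r)) →
      (∀ r, g r ∈ parityPart F n (par r)) → vf F n f (vf F n g a) =
        ∑ s, mul F n (vf F n f (g s)) (pd F n s a) +
        ∑ s, ∑ r, mul F n (mul F n (g s) (f r)) (pd F n r (pd F n s a)) := by
    intro f g _ hg
    rw [vf_apply g a, map_sum, ← Finset.sum_add_distrib]
    refine Finset.sum_congr rfl fun s _ => ?_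
    rw [vf_mul (by assumption) (hg s), vf_apply f (pd F n s a), map_sum]
    simp only [mul_assoc']
  rw [LinearMap.sub_apply, Module.End.mul_apply,
    Module.End.mul_apply, key hf hg, key hg hf, vf_apply]
  have hs : ∑ s, ∑ r, mul F n (mul F n (f s) (g r)) (pd F n r (pd F n s a)) =
      ∑ s, ∑ r, mul F n (mul F n (g s) (f r)) (pd F n r (pd F n s a)) := by
    rw [Finset.sum_comm]
    refine Finset.sum_congr rfl fun s _ => Finset.sum_congr rfl fun r _ => ?_
    rw [mul_comm' (hf r) (hg s), pd_comm s r, map_smul, map_smul, LinearMap.smul_apply, smul_smul,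
      ← pow_add, mul_comm (par s), ← two_mul, pow_mul]
    simp
  simp only [hs, add_sub_add_right_eq_sub, map_sub, LinearMap.sub_apply, Finset.sum_sub_distrib]

theorem par_swap (r : Ind n) : par r + par r.swap = 1 := by
  rcases r with i | i <;> rfl

/-- The coefficient of `∂_r` in `T_H(a)`. -/
def hc (a : DPS F n) (r : Ind n) : DPS F n := pd F n r.swap (twist F n r.swap a)

theorem TH_eq (a : DPS F n) : TH F n a = vf F n (hc a) := by
  simp only [TH, vf, hc, LinearMap.coe_mk, AddHom.coe_mk]
  refine Fintype.sum_equiv (Equiv.sumComm _ _) _ _ fun i => ?_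
  simp

theorem twist_eq {e : ℕ} {a : DPS F n} (ha : a ∈ parityPart F n e) (r : Ind n) :
    twist F n r a = (-1 : F) ^ (par r * e) • a := by
  refine mem_parity_induction (P := fun a => twist F n r a = (-1 : F) ^ (par r * e) • a) ha
    (by simp) (fun f₁ f₂ h₁ h₂ => by rw [map_add, h₁, h₂, smul_add]) fun a c h => ?_
  rw [← neg_one_pow_congr (F := F) (h.mul_left (par r))]
  simp only [twist, Finsupp.linearCombination_single, Finsupp.smul_single, smul_eq_mul, mul_comm]

theorem hc_eq {e : ℕ} {a : DPS F n} (ha : a ∈ parityPart F n e) (r : Ind n) :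
    hc a r = (-1 : F) ^ (par r.swap * e) • pd F n r.swap a := by
  rw [hc, twist_eq ha, map_smul]

theorem twist_mem_trunc {p : ℕ} {t : Fin n → ℕ} (r : Ind n) {f : DPS F n}
    (hf : f ∈ trunc F p t) : twist F n r f ∈ trunc F p t := by
  refine mem_trunc_induction (P := fun f => twist F n r f ∈ trunc F p t) hf (by simp)
    (fun f₁ f₂ h₁ h₂ => ?_) fun a c ha => ?_
  · simpa only [map_add] using add_mem h₁ h₂
  · simp only [twist, Finsupp.linearCombination_single]
    exact Submodule.smul_mem _ _ (Finsupp.single_mem_supported F _ ha)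

theorem hc_mem_trunc {p : ℕ} {t : Fin n → ℕ} {a : DPS F n} (ha : a ∈ trunc F p t) (r : Ind n) :
    hc a r ∈ trunc F p t := pd_mem_trunc _ (twist_mem_trunc _ ha)

theorem hc_mem_parityPart {e : ℕ} {a : DPS F n} (ha : a ∈ parityPart F n e) (r : Ind n) :
    hc a r ∈ parityPart F n (e + par r.swap) := by
  rw [hc_eq ha]
  exact Submodule.smul_mem _ _ (pd_mem_parityPart _ ha)

theorem hc_mem_parityPart_one {a : DPS F n} (ha : a ∈ parityPart F n 1) (r : Ind n) :
    hc a r ∈ parityPart F n (par r) := by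
  refine parityPart_congr ?_ (hc_mem_parityPart ha r)
  have := par_swap r
  change (1 + par r.swap) % 2 = par r % 2
  omega

theorem TH_apply_odd {a : DPS F n} (ha : a ∈ parityPart F n 1) (c : DPS F n) :
    TH F n a c = ∑ j : Ind n, (-1 : F) ^ par j • mul F n (pd F n j a) (pd F n j.swap c) := by
  simp only [TH, LinearMap.coe_mk, AddHom.coe_mk, LinearMap.sum_apply, LinearMap.comp_apply,
    twist_eq ha, mul_one, map_smul, LinearMap.smul_apply]

theorem TH_lie {a b : DPS F n} (ha : a ∈ parityPart F n 1) (hb : b ∈ parityPart F n 1) :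
    TH F n a * TH F n b - TH F n b * TH F n a = TH F n (TH F n a b) := by
  have hab : TH F n a b ∈ parityPart F n 1 := by
    rw [TH_eq]; exact vf_mem_parityPart (hc_mem_parityPart_one ha) hb
  have key : ∀ i : Ind n, pd F n i (TH F n a b) =
      TH F n a (pd F n i b) - TH F n b (pd F n i a) := by
    intro i
    have h1 : pd F n i (TH F n a b) =
        ∑ j : Ind n, ((-1 : F) ^ par j • mul F n (pd F n i (pd F n j a)) (pd F n j.swap b) +
          (-1 : F) ^ par j • mul F n (pd F n j a) (pd F n j.swap (pd F n i b))) := by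
      rw [TH_apply_odd ha, map_sum]
      refine Finset.sum_congr rfl fun j _ => ?_
      have hj := par_swap j
      have hs : (-1 : F) ^ (par i * (1 + par j) + par i * par j.swap) = 1 := by
        rw [← mul_add, show 1 + par j + par j.swap = 2 by omega, mul_comm, pow_mul]
        simp
      rw [map_smul, pd_mul i (pd_mem_parityPart j ha), pd_comm i j.swap, smul_add, map_smul,
        smul_smul ((-1) ^ (par i * (1 + par j))), ← pow_add, hs, one_smul]
    have h2 : TH F n b (pd F n i a) =
        -∑ j : Ind n, (-1 : F) ^ par j • mul F n (pd F n i (pd F n j a)) (pd F n j.swap b) := by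
      rw [TH_apply_odd hb, ← Finset.sum_neg_distrib]
      refine Fintype.sum_equiv (Equiv.sumComm _ _) _ _ fun j => ?_
      have hj := par_swap j
      simp only [Equiv.sumComm_apply, Sum.swap_swap]
      rw [mul_comm' (pd_mem_parityPart j hb) (pd_mem_parityPart _ (pd_mem_parityPart i ha)),
        pd_comm j.swap i, map_smul, LinearMap.smul_apply, smul_smul, smul_smul, ← pow_add,
        ← pow_add, ← neg_smul]
      congr 1
      rw [show -(-1 : F) ^ par j.swap = (-1) ^ (par j.swap + 1) by rw [pow_succ]; ring]
      refine neg_one_pow_congr ?_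
      rcases i with i | i <;> rcases j with j | j <;> simp [par, Nat.ModEq]
    rw [h1, h2, TH_apply_odd ha, Finset.sum_add_distrib]
    abel
  have hfin : (fun s => vf F n (hc a) (hc b s) - vf F n (hc b) (hc a s)) =
      hc (TH F n a b) := by
    funext s
    rw [hc_eq hab, key, hc_eq ha, hc_eq hb, map_smul, map_smul, ← TH_eq, ← TH_eq, smul_sub]
  rw [TH_eq (TH F n a b), ← hfin, ← vf_lie (hc_mem_parityPart_one ha) (hc_mem_parityPart_one hb),
    ← TH_eq, ← TH_eq]

/-- The variable `x_r`, `r ∈ Y`. -/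
def var : Ind n → DPS F n
  | Sum.inl i => Finsupp.single (Pi.single i 1, ∅) 1
  | Sum.inr k => Finsupp.single (0, {k}) 1

theorem pd_var (r s : Ind n) :
    pd F n r (var s) = if r = s then Finsupp.single (0, ∅) 1 else 0 := by
  rcases r with i | k <;> rcases s with j | l
  · simp only [var, pd_even_single, Sum.inl.injEq]
    rcases eq_or_ne i j with rfl | h
    · simp
    · simp [h]
  · simp [var, pd_even_single]
  · simp [var, pd_odd_single]
  · simp only [var, pd_odd_single, Sum.inr.injEq, Finset.mem_singleton]
    split_ifs with h
    · subst h; simp [wedgeSign]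
    · rfl

theorem mul_one' (f : DPS F n) : mul F n f (Finsupp.single (0, ∅) 1) = f := by
  induction f using Finsupp.induction_linear with
  | zero => simp
  | add f₁ f₂ h₁ h₂ => rw [map_add, LinearMap.add_apply, h₁, h₂]
  | single a c => rw [mul_single]; simp [mulCoeff, wedgeSign]

theorem vf_var (f : Ind n → DPS F n) (s : Ind n) : vf F n f (var s) = f s := by
  rw [vf_apply, Finset.sum_eq_single s]
  · rw [pd_var, if_pos rfl, mul_one']
  · intro r _ h; rw [pd_var, if_neg h, map_zero]
  · simp

theorem vf_injective : Function.Injective (vf F n) := fun f g h => by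
  funext s; rw [← vf_var f, h, vf_var]

theorem exists_parts {p : ℕ} {t : Fin n → ℕ} {a : DPS F n} (ha : a ∈ trunc F p t) :
    ∃ b c, b ∈ trunc F p t ∧ c ∈ trunc F p t ∧ b ∈ parityPart F n 0 ∧ c ∈ parityPart F n 1 ∧
      a = b + c := by
  refine mem_trunc_induction (P := fun a => ∃ b c, b ∈ trunc F p t ∧ c ∈ trunc F p t ∧
    b ∈ parityPart F n 0 ∧ c ∈ parityPart F n 1 ∧ a = b + c) ha
    ⟨0, 0, by simp, by simp, by simp, by simp, by simp⟩ ?_ fun a c h => ?_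
  · rintro _ _ ⟨b, c, h1, h2, h3, h4, rfl⟩ ⟨b', c', h1', h2', h3', h4', rfl⟩
    exact ⟨b + b', c + c', add_mem h1 h1', add_mem h2 h2', add_mem h3 h3', add_mem h4 h4',
      add_add_add_comm _ _ _ _⟩
  · have hm : Finsupp.single a c ∈ trunc F p t := Finsupp.single_mem_supported F _ h
    rcases Nat.mod_two_eq_zero_or_one #a.2 with h0 | h1
    · exact ⟨_, 0, hm, by simp, single_mem_parityPart _ h0, by simp, by simp⟩
    · exact ⟨0, _, by simp, hm, by simp, single_mem_parityPart _ h1, by simp⟩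

theorem parityPart_disjoint {e e' : ℕ} (h : ¬ e ≡ e' [MOD 2]) {f : DPS F n}
    (hf : f ∈ parityPart F n e) (hf' : f ∈ parityPart F n e') : f = 0 := by
  refine Finsupp.support_eq_empty.1 (Finset.eq_empty_of_forall_notMem fun a ha => h ?_)
  have h1 : #a.2 ≡ e [MOD 2] := (Finsupp.mem_supported F f).1 hf (by simpa using ha)
  have h2 : #a.2 ≡ e' [MOD 2] := (Finsupp.mem_supported F f).1 hf' (by simpa using ha)
  exact h1.symm.trans h2

/-- The even elements of `HO(n,n;t)` are the `T_H(a)` with `a` odd. -/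
theorem mem_hoEven_iff {p : ℕ} {t : Fin n → ℕ} (D : Module.End F (DPS F n)) :
    (D ∈ hoSub F p t ∧ D ∈ wittEvenSub F p t) ↔
      ∃ a, a ∈ trunc F p t ∧ a ∈ parityPart F n 1 ∧ TH F n a = D := by
  constructor
  · rintro ⟨⟨a, ha, rfl⟩, ⟨f, hf, hfa⟩⟩
    obtain ⟨b, c, hb, hc', hb0, hc1, rfl⟩ := exists_parts ha
    refine ⟨c, hc', hc1, ?_⟩
    rw [map_add, TH_eq b, TH_eq c, ← map_add] at hfa
    have hfa := sub_eq_iff_eq_add.2 (vf_injective hfa)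
    have h0 : hc b = 0 := by
      funext r
      have h1 : (f - hc c) r ∈ parityPart F n (par r) :=
        sub_mem (hf r trivial).2 (hc_mem_parityPart_one hc1 r)
      rw [hfa] at h1
      refine parityPart_disjoint ?_ h1 (hc_mem_parityPart hb0 r)
      rcases r with r | r <;> simp [par, Nat.ModEq]
    rw [map_add, TH_eq b, h0, map_zero, zero_add]
  · rintro ⟨a, ha, h1, rfl⟩
    refine ⟨⟨a, ha, rfl⟩, ⟨hc a, ?_, (TH_eq a).symm⟩⟩
    exact fun r _ => ⟨hc_mem_trunc ha r, hc_mem_parityPart_one h1 r⟩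

end Algebra

/-! ### The Lie algebras and the derivations -/

section Main

variable (F : Type*) [Field F] (p : ℕ) [Fact p.Prime] [CharP F p] {n : ℕ} (t : Fin n → ℕ)

/-- The Lie algebra structure on the operators on `𝒪(n,n)`, `[D, E] = DE - ED`. -/
instance endLieRing (F : Type*) [Field F] (n : ℕ) : LieRing (Module.End F (DPS F n)) :=
  LieRing.ofAssociativeRing

instance endLieAlgebra (F : Type*) [Field F] (n : ℕ) : LieAlgebra F (Module.End F (DPS F n)) :=
  LieAlgebra.ofAssociativeAlgebra

/-- The Lie algebra `𝒲`, the even part of `W(n,n;t)`, as a Lie algebra of operators on `𝒪(n,n)`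
under the commutator (which is the bracket of even elements of `W(n,n)`). -/
def wittEven : LieSubalgebra F (Module.End F (DPS F n)) where
  __ := wittEvenSub F p t
  lie_mem' := by
    rintro _ _ ⟨f, hf, rfl⟩ ⟨g, hg, rfl⟩
    refine ⟨fun s => vf F n f (g s) - vf F n g (f s), fun s _ => ⟨?_, ?_⟩,
      (vf_lie (fun r => (hf r trivial).2) (fun r => (hg r trivial).2)).symm⟩
    · exact sub_mem (vf_mem_trunc (fun r => (hf r trivial).1) (hg s trivial).1)
        (vf_mem_trunc (fun r => (hg r trivial).1) (hf s trivial).1)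
    · exact sub_mem (vf_mem_parityPart (fun r => (hf r trivial).2) (hg s trivial).2)
        (vf_mem_parityPart (fun r => (hg r trivial).2) (hf s trivial).2)

/-- The Lie algebra `ℋ𝒪`, the even part of `HO(n,n;t)`, as a subalgebra of `𝒲`. -/
def hoEven : LieSubalgebra F (wittEven F p t) where
  __ := (hoSub F p t).comap (wittEven F p t).toSubmodule.subtype
  lie_mem' := by
    rintro ⟨x, hx⟩ ⟨y, hy⟩ hx' hy'
    obtain ⟨a, ha, ha1, rfl⟩ := (mem_hoEven_iff x).1 ⟨hx', hx⟩
    obtain ⟨b, hb, hb1, rfl⟩ := (mem_hoEven_iff y).1 ⟨hy', hy⟩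
    refine ⟨TH F n a b, ?_, (TH_lie ha1 hb1).symm⟩
    rw [TH_eq]
    exact vf_mem_trunc (hc_mem_trunc ha) hb

/-- The component `𝒲_d` of the `ℤ`-grading of `𝒲`. -/
def wittEvenDeg (d : ℤ) : Submodule F (wittEven F p t) :=
  (wittDeg F p t d).comap (wittEven F p t).toSubmodule.subtype

/-- The component `ℋ𝒪_d = ℋ𝒪 ∩ 𝒲_d` of the `ℤ`-grading of `ℋ𝒪`. -/
def hoEvenDeg (d : ℤ) : Submodule F (hoEven F p t) :=
  (wittEvenDeg F p t d).comap (hoEven F p t).toSubmodule.subtype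

/-- `Der_d(ℋ𝒪, 𝒲)`: the derivations `D` from `ℋ𝒪` into the `ℋ𝒪`-module `𝒲` with
`D(ℋ𝒪_i) ⊆ 𝒲_{d+i}` for all `i ∈ ℤ`. -/
def derDeg (d : ℤ) : Submodule F (LieDerivation F (hoEven F p t) (wittEven F p t)) where
  carrier := {D | ∀ i : ℤ, ∀ x ∈ hoEvenDeg F p t i, D x ∈ wittEvenDeg F p t (d + i)}
  zero_mem' := fun _ _ _ => Submodule.zero_mem _
  add_mem' := fun h₁ h₂ i x hx => Submodule.add_mem _ (h₁ i x hx) (h₂ i x hx)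
  smul_mem' := fun c _ h i x hx => Submodule.smul_mem _ c (h i x hx)

/-- The map `E ↦ ad E`, where `ad E : ℋ𝒪 → 𝒲` is the derivation `x ↦ [E, x]`. -/
def adW : wittEven F p t →ₗ[F] LieDerivation F (hoEven F p t) (wittEven F p t) :=
  -LieDerivation.inner F (hoEven F p t) (wittEven F p t)

theorem adW_apply (E : wittEven F p t) (x : hoEven F p t) :
    adW F p t E x = ⁅E, (x : wittEven F p t)⁆ := by
  rw [← lie_skew]
  rfl

end Main

end OddHamiltonian

end

/-! The plan is to subtract inner derivations from D until nothing is left. Three pieces of ℋ𝒪 do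
the work: the fields T_H(x_{i'}) = -∂_i, which span ℋ𝒪_{-1}; the torus elements h_i = T_H(x_i
x_{i'}), which act diagonally on monomials; and a few elements T_H(x^u).

Agreement on ℋ𝒪_{-1} means integrating the system ∂_i E = D(T_H(x_{i'})), coefficient by
coefficient. It is compatible because the ∂_i commute, and in truncated divided powers the only
obstruction is a term whose i-th exponent is p^{t_i} - 1. Since ad ∂_i has vanishing p^{t_i}-th
power on ℋ𝒪 and on 𝒲, a Frobenius argument on Hom(ℋ𝒪, 𝒲) shows that (ad ∂_i)^{p^{t_i} - 1} D(∂_i) is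
centralized by ℋ𝒪. The centralizer is zero (`eq_zero_of_centralizes`), so no such term occurs
(`pd_pow_cf_var`).

On the torus, the values D(h_i) satisfy the cocycle condition of a commuting diagonalizable family.
Dividing by weights removes every component of nonzero weight, and what remains of D(h_i) again lies
in the centralizer, hence is zero.

Now D preserves torus weights. By induction on |α|, the coefficients of D(T_H(x^(α) x^u)) are killed
by all ∂_i, so they lie in the exterior algebra. The weights agree modulo p and the degrees agree in
ℤ; for p ≥ 5 these two facts force D = 0 if d > 0 (`cf_coeff_weight`). If d = 0, only α = 0 and α =
ε_j can give a nonzero value.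

In degree zero, D(T_H(x_i x_{j'})) = q_{ij} x_{j'} ∂_{i'} with q an additive cocycle, hence a
coboundary, which the bracket with a field ∑ b_j x_{j'} ∂_{j'} realizes. On one T_H(x^u) with |u| =
3 the derivation is then a scalar, removed by a multiple of the odd Euler field. The kernel of D is
a subalgebra, and brackets of elements already in it produce all remaining T_H(x^u) and T_H(x_j
x^u). -/

noncomputable section

namespace OddHamiltonian

open Finset

/-! ### Degrees, and the actions of ∂_i, the torus and exterior monomials -/

section Operators

variable {F : Type*} [Field F] {n : ℕ}

/-- The degree `|α| + |u|` of the monomial `x^(α) x^u`. -/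
def mdeg (a : Mono n) : ℕ := ∑ i, a.1 i + #a.2

theorem single_mem_degPart (a : Mono n) (c : F) :
    Finsupp.single a c ∈ degPart F n (mdeg a) :=
  Finsupp.single_mem_supported F _ rfl

theorem mem_deg_induction {d : ℤ} {P : DPS F n → Prop} {f : DPS F n}
    (hf : f ∈ degPart F n d) (h0 : P 0) (hadd : ∀ f g, P f → P g → P (f + g))
    (hs : ∀ (a : Mono n) (c : F), (mdeg a : ℤ) = d → P (Finsupp.single a c)) : P f := by
  rw [← Finsupp.sum_single f]
  refine Finset.sum_induction _ P hadd h0 fun a ha => hs a _ ?_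
  exact (Finsupp.mem_supported F f).1 hf (by simpa using ha)

theorem sum_sub_single {α : Fin n → ℕ} {i : Fin n} (h : α i ≠ 0) :
    ∑ j, (α - Pi.single i 1 : Fin n → ℕ) j + 1 = ∑ j, α j := by
  have h1 := Finset.add_sum_erase univ (fun j => α j) (mem_univ i)
  have h2 := Finset.add_sum_erase univ (fun j => (α - Pi.single i 1 : Fin n → ℕ) j) (mem_univ i)
  have h3 : ∑ j ∈ univ.erase i, (α - Pi.single i 1 : Fin n → ℕ) j = ∑ j ∈ univ.erase i, α j :=
    Finset.sum_congr rfl fun j hj => by simp [Finset.ne_of_mem_erase hj]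
  have h4 : (α - Pi.single i 1 : Fin n → ℕ) i = α i - 1 := by simp
  simp only [h3, h4] at h1 h2
  omega

theorem mul_mem_degPart {d e : ℤ} {f g : DPS F n} (hf : f ∈ degPart F n d)
    (hg : g ∈ degPart F n e) : mul F n f g ∈ degPart F n (d + e) := by
  refine mem_deg_induction (P := fun f => mul F n f g ∈ degPart F n (d + e)) hf (by simp)
    (fun f₁ f₂ h₁ h₂ => ?_) fun a c ha => ?_
  · simpa only [map_add, LinearMap.add_apply] using add_mem h₁ h₂
  refine mem_deg_induction
    (P := fun g => mul F n (Finsupp.single a c) g ∈ degPart F n (d + e)) hg (by simp)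
    (fun f₁ f₂ h₁ h₂ => ?_) fun b c' hb => ?_
  · simpa only [map_add] using add_mem h₁ h₂
  rw [mul_single]
  by_cases h : Disjoint a.2 b.2
  · refine Finsupp.single_mem_supported F _ ?_
    simp only [Set.mem_ofPred_eq, Finset.card_union_of_disjoint h, Pi.add_apply,
      Finset.sum_add_distrib]
    rw [← ha, ← hb]
    simp only [mdeg]
    push_cast
    ring
  · obtain ⟨i, hi, hi'⟩ := Finset.not_disjoint_iff.1 h
    simp [mulCoeff, wedgeSign_eq_zero hi hi']

theorem pd_mem_degPart (r : Ind n) {d : ℤ} {f : DPS F n} (hf : f ∈ degPart F n d) :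
    pd F n r f ∈ degPart F n (d - 1) := by
  refine mem_deg_induction (P := fun f => pd F n r f ∈ degPart F n (d - 1)) hf (by simp)
    (fun f₁ f₂ h₁ h₂ => ?_) fun a c ha => ?_
  · simpa only [map_add] using add_mem h₁ h₂
  rcases r with i | k
  · rw [pd_even_single]
    split_ifs with h
    · simp
    · refine Finsupp.single_mem_supported F _ ?_
      have := sum_sub_single h
      simp only [Set.mem_ofPred_eq]
      simp only [mdeg] at ha
      omega
  · rw [pd_odd_single]
    split_ifs with h
    · refine Finsupp.single_mem_supported F _ ?_
      have h1 : #(a.2.erase k) + 1 = #a.2 := Finset.card_erase_add_one h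
      simp only [Set.mem_ofPred_eq]
      simp only [mdeg] at ha
      omega
    · simp

theorem hc_mem_degPart {d : ℤ} {a : DPS F n} (h1 : a ∈ parityPart F n 1)
    (ha : a ∈ degPart F n d) (r : Ind n) : hc a r ∈ degPart F n (d - 1) := by
  rw [hc_eq h1]
  exact Submodule.smul_mem _ _ (pd_mem_degPart _ ha)

theorem vf_mem_degPart {d e : ℤ} {f : Ind n → DPS F n} (hf : ∀ r, f r ∈ degPart F n (d + 1))
    {a : DPS F n} (ha : a ∈ degPart F n e) : vf F n f a ∈ degPart F n (d + e) := by
  rw [vf_apply]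
  refine Submodule.sum_mem _ fun r _ => ?_
  have := mul_mem_degPart (hf r) (pd_mem_degPart r ha)
  rwa [show d + 1 + (e - 1) = d + e by ring] at this

theorem coeff_mem_parityPart {e : ℕ} {f : DPS F n} (hf : f ∈ parityPart F n e) {a : Mono n}
    (h : f a ≠ 0) : #a.2 ≡ e [MOD 2] :=
  (Finsupp.mem_supported F f).1 hf (by simpa using h)

theorem coeff_mem_degPart {d : ℤ} {f : DPS F n} (hf : f ∈ degPart F n d) {a : Mono n}
    (h : f a ≠ 0) : (mdeg a : ℤ) = d :=
  (Finsupp.mem_supported F f).1 hf (by simpa using h)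

theorem coeff_mem_trunc {p : ℕ} {t : Fin n → ℕ} {f : DPS F n} (hf : f ∈ trunc F p t)
    {a : Mono n} (h : f a ≠ 0) (i : Fin n) : a.1 i ≤ p ^ t i - 1 :=
  (Finsupp.mem_supported F f).1 hf (by simpa using h : a ∈ (f.support : Set (Mono n))) i

/-- In divided powers ∂_i is a pure shift of coefficients, with no numerical factor. Hence
integrating is shifting back, in any characteristic. -/
theorem pd_even_apply (i : Fin n) (f : DPS F n) (a : Mono n) :
    pd F n (Sum.inl i) f a = f (a.1 + Pi.single i 1, a.2) := by
  induction f using Finsupp.induction_linear with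
  | zero => simp
  | add f₁ f₂ h₁ h₂ => simp only [map_add, Finsupp.add_apply, h₁, h₂]
  | single b c =>
    rw [pd_even_single]
    split_ifs with h
    · rw [Finsupp.single_eq_of_ne, Finsupp.zero_apply]
      rintro rfl
      simp at h
    · rcases a with ⟨α, u⟩
      rcases b with ⟨β, v⟩
      simp only at h
      have : (β - Pi.single i 1, v) = (α, u) ↔ (β, v) = (α + Pi.single i 1, u) := by
        simp only [Prod.mk.injEq]
        refine and_congr_left fun _ => ⟨fun hb => ?_, fun hb => ?_⟩
        · rw [← hb]
          funext j
          rcases eq_or_ne j i with rfl | hj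
          · simp; omega
          · simp [hj]
        · rw [hb]; simp
      by_cases hb : (β, v) = (α + Pi.single i 1, u)
      · rw [hb, Finsupp.single_eq_same, ← hb, this.2 hb, Finsupp.single_eq_same]
      · rw [Finsupp.single_eq_of_ne' hb, Finsupp.single_eq_of_ne' (fun h => hb (this.1 h))]

theorem mul_one_left (f : DPS F n) (c : F) : mul F n (Finsupp.single (0, ∅) c) f = c • f := by
  induction f using Finsupp.induction_linear with
  | zero => simp
  | add f₁ f₂ h₁ h₂ => rw [map_add, h₁, h₂, smul_add]
  | single a c => rw [mul_single]; simp [mulCoeff, wedgeSign]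

theorem mulCoeff_var (i : Fin n) (a : Mono n) :
    mulCoeff (Pi.single i 1, ∅) a = a.1 i + 1 := by
  simp only [mulCoeff, wedgeSign, Finset.prod_empty, mul_one]
  rw [Finset.prod_eq_single i]
  · simp [add_comm 1]
  · intro j _ h; simp [h]
  · simp

theorem mulCoeff_odd (v : Finset (Fin n)) (a : Mono n) :
    mulCoeff (0, v) a = wedgeSign v a.2 := by
  simp [mulCoeff]

/-- `x_j' ∂_i'` on a monomial. -/
theorem odd_transvection_single (i j : Fin n) (a : Mono n) (c : F) :
    mul F n (var (Sum.inr j)) (pd F n (Sum.inr i) (Finsupp.single a c)) =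
      if i ∈ a.2 then Finsupp.single (a.1, insert j (a.2.erase i))
        (c * ((wedgeSign {i} (a.2.erase i) * wedgeSign {j} (a.2.erase i) : ℤ) : F)) else 0 := by
  rw [pd_odd_single]
  split_ifs with h
  · rw [var, mul_single, mulCoeff_odd]
    simp only [zero_add, one_mul, ← Finset.insert_eq]
    push_cast
    rw [mul_assoc]
  · simp

theorem odd_euler_single (i : Fin n) (a : Mono n) (c : F) :
    mul F n (var (Sum.inr i)) (pd F n (Sum.inr i) (Finsupp.single a c)) =
      if i ∈ a.2 then Finsupp.single a c else 0 := by
  rw [odd_transvection_single]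
  split_ifs with h
  · rw [wedgeSign_sq (Finset.notMem_erase i a.2), Finset.insert_erase h]
    simp
  · rfl

theorem even_euler_single (i : Fin n) (a : Mono n) (c : F) :
    mul F n (var (Sum.inl i)) (pd F n (Sum.inl i) (Finsupp.single a c)) =
      Finsupp.single a (c * (a.1 i : F)) := by
  rw [pd_even_single]
  split_ifs with h
  · simp [h]
  · rw [var, mul_single, mulCoeff_var]
    have : Pi.single i 1 + (a.1 - Pi.single i 1) = a.1 := by
      funext j
      rcases eq_or_ne j i with rfl | hj
      · simp; omega
      · simp [hj]
    simp only [this, Finset.empty_union, one_mul]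
    congr 2
    simp only [Pi.sub_apply, Pi.single_eq_same]
    rw [Nat.cast_sub (by omega)]
    simp

theorem var_inr_mem (i : Fin n) : (var (Sum.inr i) : DPS F n) ∈ parityPart F n 1 :=
  single_mem_parityPart _ rfl

/-- The element `x_i x_j'` of `𝒪(n,n)`. -/
def xe (F : Type*) [Field F] {n : ℕ} (i j : Fin n) : DPS F n :=
  Finsupp.single (Pi.single i 1, {j}) 1

theorem xe_mem (i j : Fin n) : xe F i j ∈ parityPart F n 1 := single_mem_parityPart _ rfl

theorem TH_var (i : Fin n) (f : DPS F n) :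
    TH F n (var (Sum.inr i)) f = -pd F n (Sum.inl i) f := by
  rw [TH_apply_odd (var_inr_mem i), Finset.sum_eq_single (Sum.inr i)]
  · rw [pd_var, if_pos rfl, mul_one_left]
    simp [par]
  · intro r _ h
    rw [pd_var, if_neg h]
    simp
  · simp

theorem hc_var (i : Fin n) (s : Ind n) :
    hc (var (Sum.inr i) : DPS F n) s =
      Finsupp.single (0, ∅) (if s = Sum.inl i then -1 else 0) := by
  rw [hc_eq (var_inr_mem i), pd_var]
  rcases s with l | l
  · by_cases h : l = i
    · simp [h, par]
    · simp [h]
  · simp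

theorem vf_const (f : Ind n → DPS F n) (c : F) : vf F n f (Finsupp.single (0, ∅) c) = 0 := by
  rw [vf_apply]
  refine Finset.sum_eq_zero fun r _ => ?_
  rcases r with i | i
  · simp [pd_even_single]
  · simp [pd_odd_single]

theorem pd_xe (i j : Fin n) (r : Ind n) : pd F n r (xe F i j) =
    if r = Sum.inl i then var (Sum.inr j) else if r = Sum.inr j then var (Sum.inl i) else 0 := by
  rcases r with l | l
  · by_cases h : l = i
    · subst h; simp [xe, var, pd_even_single]
    · simp [xe, pd_even_single, h]
  · by_cases h : l = j
    · subst h; simp [xe, var, pd_odd_single, wedgeSign]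
    · simp [xe, pd_odd_single, h]

theorem TH_xe (i j : Fin n) (f : DPS F n) :
    TH F n (xe F i j) f = mul F n (var (Sum.inr j)) (pd F n (Sum.inr i) f) -
      mul F n (var (Sum.inl i)) (pd F n (Sum.inl j) f) := by
  rw [TH_apply_odd (xe_mem i j), Fintype.sum_sum_type, Finset.sum_eq_single i,
    Finset.sum_eq_single j]
  · simp [pd_xe, par, sub_eq_add_neg]
  · intro l _ h; simp [pd_xe, h]
  · simp
  · intro l _ h; simp [pd_xe, h]
  · simp

theorem hc_xe (i j : Fin n) (s : Ind n) :
    hc (xe F i j) s = if s = Sum.inl j then -var (Sum.inl i) else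
      if s = Sum.inr i then var (Sum.inr j) else 0 := by
  rw [hc_eq (xe_mem i j), pd_xe]
  rcases s with l | l
  · by_cases h : l = j <;> simp [h, par]
  · by_cases h : l = i <;> simp [h, par]

/-- The weight of the monomial `a` for the `i`-th element of the torus of `ℋ𝒪`. -/
def wt (F : Type*) [Field F] {n : ℕ} (i : Fin n) (a : Mono n) : F :=
  (if i ∈ a.2 then 1 else 0) - (a.1 i : F)

/-- The weight of `x^(α) x^u ∂_s` for the `i`-th element of the torus of `ℋ𝒪`. -/
def lam (F : Type*) [Field F] {n : ℕ} (i : Fin n) (s : Ind n) (a : Mono n) : F :=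
  wt F i a + (if s = Sum.inl i then 1 else 0) - if s = Sum.inr i then 1 else 0

theorem TH_xe_self_single (i : Fin n) (a : Mono n) (c : F) :
    TH F n (xe F i i) (Finsupp.single a c) = Finsupp.single a (wt F i a * c) := by
  rw [TH_xe, odd_euler_single, even_euler_single, wt, sub_mul, Finsupp.single_sub, mul_comm c]
  split_ifs <;> simp

theorem TH_xe_self_apply (i : Fin n) (f : DPS F n) (a : Mono n) :
    TH F n (xe F i i) f a = wt F i a * f a := by
  induction f using Finsupp.induction_linear with
  | zero => simp
  | add f₁ f₂ h₁ h₂ => simp only [map_add, Finsupp.add_apply, h₁, h₂, mul_add]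
  | single b c =>
    rw [TH_xe_self_single]
    by_cases h : b = a
    · simp [h]
    · simp [Finsupp.single_eq_of_ne' h]

/-- The bracket with h_i is diagonal on the basis x^(α) x^u ∂_s. The two corrections in `lam` are
the weight of ∂_s itself, coming from h_i applied to the variable x_s. -/
theorem lie_xe_self_apply (i : Fin n) (f : Ind n → DPS F n) (s : Ind n) (a : Mono n) :
    (TH F n (xe F i i) (f s) - vf F n f (hc (xe F i i) s)) a = lam F i s a * f s a := by
  rw [Finsupp.sub_apply, TH_xe_self_apply, hc_xe, lam]
  rcases s with l | l
  · by_cases h : l = i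
    · subst h; simp [vf_var]; ring
    · simp [h]
  · by_cases h : l = i
    · subst h; simp [vf_var]; ring
    · simp [h]

theorem TH_odd_single {a b : Mono n} (ha : #a.2 ≡ 1 [MOD 2]) (hb : b.1 = 0) (c : F) :
    TH F n (Finsupp.single a 1) (Finsupp.single b c) =
      ∑ k, mul F n (pd F n (Sum.inl k) (Finsupp.single a 1))
        (pd F n (Sum.inr k) (Finsupp.single b c)) := by
  rw [TH_apply_odd (single_mem_parityPart _ ha), Fintype.sum_sum_type]
  have : ∀ k : Fin n, pd F n (Sum.inl k) (Finsupp.single b c) = 0 := fun k => by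
    rw [pd_even_single, hb]; simp
  simp [this, par]

theorem wedgeSign_ne_zero {u v : Finset (Fin n)} (h : Disjoint u v) :
    ((wedgeSign u v : ℤ) : F) ≠ 0 := by
  have : ∀ i ∈ u, ∀ j ∈ v, ((pairSign i j : ℤ) : F) ≠ 0 := fun i hi j hj => by
    have hij : i ≠ j := fun e => Finset.disjoint_left.1 h hi (e ▸ hj)
    rcases lt_or_gt_of_ne hij with h | h <;> simp [pairSign, h, h.not_gt]
  simp only [wedgeSign, Int.cast_prod]
  exact Finset.prod_ne_zero_iff.2 fun i hi => Finset.prod_ne_zero_iff.2 fun j hj => this i hi j hj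

/-- The bracket of a monomial with a monomial of the exterior algebra, if only one pair of
derivatives contributes. -/
theorem TH_odd_single_eq {a : Mono n} {w : Finset (Fin n)} {i : Fin n} (ha : #a.2 ≡ 1 [MOD 2])
    (hi : i ∈ w) (hai : a.1 i ≠ 0) (hd : Disjoint a.2 (w.erase i))
    (hk : ∀ k ∈ w, k ≠ i → a.1 k ≠ 0 → ¬ Disjoint a.2 (w.erase k)) :
    ∃ c : F, c ≠ 0 ∧ TH F n (Finsupp.single a 1) (Finsupp.single (0, w) 1) =
      Finsupp.single (a.1 - Pi.single i 1, a.2 ∪ w.erase i) c := by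
  refine ⟨(wedgeSign {i} (w.erase i) : ℤ) * (wedgeSign a.2 (w.erase i) : ℤ),
    mul_ne_zero (wedgeSign_ne_zero (by simp)) (wedgeSign_ne_zero hd), ?_⟩
  have hm : ∀ (x : Fin n → ℕ) (u v : Finset (Fin n)), mulCoeff (x, u) (0, v) = wedgeSign u v :=
    fun x u v => by simp [mulCoeff]
  rw [TH_odd_single ha rfl, Finset.sum_eq_single i]
  · rw [pd_even_single, if_neg hai, pd_odd_single, if_pos hi, mul_single, hm]
    simp
  · intro k _ hki
    rw [pd_even_single, pd_odd_single]
    by_cases h1 : a.1 k = 0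
    · simp [h1]
    by_cases h2 : k ∈ w
    · rw [if_neg h1, if_pos h2, mul_single, hm]
      -- Where both derivatives survive, the product contains an odd variable twice.
      obtain ⟨j, hj, hj'⟩ := Finset.not_disjoint_iff.1 (hk k h2 hki h1)
      simp [wedgeSign_eq_zero hj hj']
    · simp [h2]
  · simp

/-- The coefficients of the vector field `∑ b_j x_j' ∂_j'`. -/
def dg (b : Fin n → F) : Ind n → DPS F n
  | Sum.inl _ => 0
  | Sum.inr j => b j • var (Sum.inr j)

theorem vf_dg_single (b : Fin n → F) (a : Mono n) (c : F) :
    vf F n (dg b) (Finsupp.single a c) = Finsupp.single a ((∑ j ∈ a.2, b j) * c) := by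
  rw [vf_apply, Fintype.sum_sum_type]
  simp only [dg, map_zero, LinearMap.zero_apply, Finset.sum_const_zero, zero_add, map_smul,
    LinearMap.smul_apply, odd_euler_single]
  rw [Finset.sum_mul, Finsupp.single_finsetSum, ← Finset.sum_subset (Finset.subset_univ a.2)]
  · refine Finset.sum_congr rfl fun j hj => ?_
    simp [hj]
  · intro j _ hj; simp [hj]

end Operators

/-! ### Coefficients of elements of 𝒲 and of values of derivations -/

section Derivations

variable {F : Type*} [Field F] {p : ℕ} {n : ℕ} {t : Fin n → ℕ}

/-- The `T_H(x^b)` with `Adm p t b` span `ℋ𝒪`. -/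
def Adm (p : ℕ) (t : Fin n → ℕ) (b : Mono n) : Prop :=
  (∀ i, b.1 i ≤ p ^ t i - 1) ∧ #b.2 ≡ 1 [MOD 2]

theorem adm_odd {u : Finset (Fin n)} (hu : #u ≡ 1 [MOD 2]) : Adm p t (0, u) :=
  ⟨fun _ => Nat.zero_le _, hu⟩

theorem Adm.sub_single {b : Mono n} (hb : Adm p t b) (i : Fin n) :
    Adm p t (b.1 - Pi.single i 1, b.2) :=
  ⟨fun j => (Nat.sub_le _ _).trans (hb.1 j), hb.2⟩

/-- The span of the odd monomials of `𝒪(n,n;t)`. -/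
def oddTrunc (F : Type*) [Field F] (p : ℕ) (t : Fin n → ℕ) : Submodule F (DPS F n) :=
  trunc F p t ⊓ parityPart F n 1

theorem single_mem_oddTrunc {b : Mono n} (hb : Adm p t b) (c : F) :
    Finsupp.single b c ∈ oddTrunc F p t :=
  ⟨Finsupp.single_mem_supported F c hb.1, single_mem_parityPart c hb.2⟩

open Classical in
/-- The projection of `𝒪(n,n)` onto the span of the odd monomials of `𝒪(n,n;t)`. -/
def oddPart (F : Type*) [Field F] (p : ℕ) (t : Fin n → ℕ) : DPS F n →ₗ[F] DPS F n :=
  (Finsupp.supported F F {b | Adm p t b}).subtype ∘ₗ Finsupp.restrictDom F F {b | Adm p t b}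

theorem oddPart_mem (a : DPS F n) : oddPart F p t a ∈ oddTrunc F p t := by
  have h : oddPart F p t a ∈ Finsupp.supported F F {b | Adm p t b} := Subtype.coe_prop _
  exact ⟨Finsupp.supported_mono (fun _ hb => hb.1) h, Finsupp.supported_mono (fun _ hb => hb.2) h⟩

theorem oddPart_eq {a : DPS F n} (ha : a ∈ oddTrunc F p t) : oddPart F p t a = a := by
  classical
  have : oddPart F p t a = Finsupp.filter (· ∈ {b | Adm p t b}) a := by
    simp only [oddPart, LinearMap.comp_apply, Submodule.subtype_apply, Finsupp.restrictDom_apply]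
  rw [this, Finsupp.filter_eq_self_iff]
  exact fun b hb => ⟨coeff_mem_trunc ha.1 hb, coeff_mem_parityPart ha.2 hb⟩

theorem var_mem_oddTrunc (i : Fin n) : var (Sum.inr i) ∈ oddTrunc F p t :=
  single_mem_oddTrunc (b := (0, {i})) ⟨fun _ => Nat.zero_le _, rfl⟩ 1

section

variable [Fact p.Prime]

theorem one_le_pow_sub_one (ht : ∀ i, 1 ≤ t i) (i : Fin n) : 1 ≤ p ^ t i - 1 := by
  have h2 : 2 ≤ p := (Fact.out : p.Prime).two_le
  have : p ^ 1 ≤ p ^ t i := Nat.pow_le_pow_right (by omega) (ht i)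
  rw [pow_one] at this
  omega

theorem adm_single (ht : ∀ i, 1 ≤ t i) (i : Fin n) {u : Finset (Fin n)} (hu : #u ≡ 1 [MOD 2]) :
    Adm p t (Pi.single i 1, u) := by
  refine ⟨fun j => ?_, hu⟩
  have := one_le_pow_sub_one (p := p) ht j
  rcases eq_or_ne j i with rfl | h
  · simpa using this
  · simp [h]

theorem adm_single_add (ht : ∀ i, 1 ≤ t i) {i j : Fin n} (hij : i ≠ j) {u : Finset (Fin n)}
    (hu : #u ≡ 1 [MOD 2]) : Adm p t (Pi.single i 1 + Pi.single j 1, u) := by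
  refine ⟨fun k => ?_, hu⟩
  have := one_le_pow_sub_one (p := p) ht k
  rcases eq_or_ne k i with rfl | h
  · simpa [hij] using this
  · rcases eq_or_ne k j with rfl | h'
    · simpa [h] using this
    · simp [h, h']

theorem xe_mem_oddTrunc (ht : ∀ i, 1 ≤ t i) (i j : Fin n) : xe F i j ∈ oddTrunc F p t :=
  single_mem_oddTrunc (adm_single ht i (u := {j}) rfl) 1

end

variable [Fact p.Prime] [CharP F p]

theorem TH_mem_oddTrunc {a b : DPS F n} (ha : a ∈ oddTrunc F p t) (hb : b ∈ oddTrunc F p t) :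
    TH F n a b ∈ oddTrunc F p t := by
  rw [TH_eq]
  exact ⟨vf_mem_trunc (hc_mem_trunc ha.1) hb.1, vf_mem_parityPart (hc_mem_parityPart_one ha.2) hb.2⟩

/-- The element `T_H(a)` of `ℋ𝒪`, for `a` in the span of the odd monomials of `𝒪(n,n;t)`. -/
def hoT (F : Type*) [Field F] (p : ℕ) [Fact p.Prime] [CharP F p] (t : Fin n → ℕ) :
    DPS F n →ₗ[F] hoEven F p t where
  toFun a := ⟨⟨TH F n (oddPart F p t a), ((mem_hoEven_iff _).2
      ⟨_, (oddPart_mem a).1, (oddPart_mem a).2, rfl⟩).2⟩, _, (oddPart_mem a).1, rfl⟩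
  map_add' a b := by
    refine Subtype.ext (Subtype.ext ?_)
    simp
  map_smul' c a := by
    refine Subtype.ext (Subtype.ext ?_)
    simp

theorem coe_hoT {a : DPS F n} (ha : a ∈ oddTrunc F p t) :
    ((hoT F p t a : wittEven F p t) : Module.End F (DPS F n)) = TH F n a := by
  change TH F n (oddPart F p t a) = _
  rw [oddPart_eq ha]

theorem exists_hoT (x : hoEven F p t) : ∃ a ∈ oddTrunc F p t, hoT F p t a = x := by
  obtain ⟨a, ha, h1, h⟩ := (mem_hoEven_iff _).1 ⟨x.2, x.1.2⟩
  exact ⟨a, ⟨ha, h1⟩, Subtype.ext (Subtype.ext ((coe_hoT ⟨ha, h1⟩).trans h))⟩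

/-- The coefficient of `∂_s` in an element of `𝒲`. -/
def co (V : wittEven F p t) (s : Ind n) : DPS F n := (V : Module.End F (DPS F n)) (var s)

theorem coe_eq_vf (V : wittEven F p t) : (V : Module.End F (DPS F n)) = vf F n (co V) := by
  obtain ⟨_, f, hf, rfl⟩ := V
  exact congrArg (vf F n) (funext fun s => (vf_var f s).symm)

theorem co_mem (V : wittEven F p t) (s : Ind n) :
    co V s ∈ trunc F p t ∧ co V s ∈ parityPart F n (par s) := by
  obtain ⟨_, f, hf, rfl⟩ := V
  change vf F n f (var s) ∈ _ ∧ vf F n f (var s) ∈ _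
  rw [vf_var]
  exact hf s trivial

/-- A vector field is determined by its values at the variables. -/
theorem co_ext {V W : wittEven F p t} (h : ∀ s, co V s = co W s) : V = W :=
  Subtype.ext (by rw [coe_eq_vf, coe_eq_vf, funext h])

theorem co_add (V W : wittEven F p t) (s : Ind n) : co (V + W) s = co V s + co W s := rfl

theorem co_sub (V W : wittEven F p t) (s : Ind n) : co (V - W) s = co V s - co W s := rfl

theorem co_zero (s : Ind n) : co (0 : wittEven F p t) s = 0 := rfl

theorem co_smul (c : F) (V : wittEven F p t) (s : Ind n) : co (c • V) s = c • co V s := rfl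

theorem co_lie (V W : wittEven F p t) (s : Ind n) :
    co ⁅V, W⁆ s = vf F n (co V) (co W s) - vf F n (co W) (co V s) := by
  rw [← coe_eq_vf, ← coe_eq_vf]
  rfl

theorem mem_wittEvenDeg {V : wittEven F p t} {d : ℤ} :
    V ∈ wittEvenDeg F p t d ↔ ∀ s, co V s ∈ degPart F n (d + 1) := by
  constructor
  · rintro ⟨f, hf, h⟩ s
    have : co V s = f s := by
      rw [← vf_var f s, h]; rfl
    rw [this]
    exact (hf s trivial).2
  · exact fun h => ⟨co V, fun s _ => ⟨(co_mem V s).1, h s⟩, (coe_eq_vf V).symm⟩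

/-- The element `∑ f_s ∂_s` of `𝒲`. -/
def ofCo (f : Ind n → DPS F n) (hf : ∀ s, f s ∈ trunc F p t ∧ f s ∈ parityPart F n (par s)) :
    wittEven F p t :=
  ⟨vf F n f, f, fun s _ => hf s, rfl⟩

theorem co_ofCo (f : Ind n → DPS F n)
    (hf : ∀ s, f s ∈ trunc F p t ∧ f s ∈ parityPart F n (par s)) (s : Ind n) :
    co (ofCo f hf) s = f s := vf_var f s

theorem co_hoT {a : DPS F n} (ha : a ∈ oddTrunc F p t) (s : Ind n) :
    co (hoT F p t a : wittEven F p t) s = hc a s := by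
  rw [co, coe_hoT ha, TH_eq, vf_var]

theorem vf_co_hoT {a : DPS F n} (ha : a ∈ oddTrunc F p t) :
    vf F n (co (hoT F p t a : wittEven F p t)) = TH F n a := by
  rw [← coe_eq_vf, coe_hoT ha]

theorem hoT_lie {a b : DPS F n} (ha : a ∈ oddTrunc F p t) (hb : b ∈ oddTrunc F p t) :
    ⁅hoT F p t a, hoT F p t b⁆ = hoT F p t (TH F n a b) := by
  refine Subtype.ext (Subtype.ext ?_)
  rw [coe_hoT (TH_mem_oddTrunc ha hb), ← TH_lie ha.2 hb.2, ← coe_hoT ha, ← coe_hoT hb]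
  rfl

theorem hoT_mem_deg {a : DPS F n} (ha : a ∈ oddTrunc F p t) {e : ℤ} (he : a ∈ degPart F n e) :
    hoT F p t a ∈ hoEvenDeg F p t (e - 2) := by
  change (hoT F p t a : wittEven F p t) ∈ wittEvenDeg F p t (e - 2)
  rw [mem_wittEvenDeg]
  intro s
  rw [co_hoT ha, show e - 2 + 1 = e - 1 by ring]
  exact hc_mem_degPart ha.2 he s

theorem lie_mem_wittEvenDeg {V W : wittEven F p t} {d e : ℤ} (hV : V ∈ wittEvenDeg F p t d)
    (hW : W ∈ wittEvenDeg F p t e) : ⁅V, W⁆ ∈ wittEvenDeg F p t (d + e) := by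
  rw [mem_wittEvenDeg] at *
  intro s
  rw [co_lie]
  refine sub_mem ?_ ?_
  · rw [add_assoc]
    exact vf_mem_degPart hV (hW s)
  · rw [add_comm d, add_assoc]
    exact vf_mem_degPart hW (hV s)

theorem adW_mem_derDeg {E : wittEven F p t} {d : ℤ} (hE : E ∈ wittEvenDeg F p t d) :
    adW F p t E ∈ derDeg F p t d := fun i x hx => by
  rw [adW_apply]
  exact lie_mem_wittEvenDeg hE hx

/-- The coefficient of `∂_s` in the value of a derivation at `T_H(a)`. -/
def cf (D : LieDerivation F (hoEven F p t) (wittEven F p t)) (a : DPS F n) (s : Ind n) : DPS F n :=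
  co (D (hoT F p t a)) s

variable (D : LieDerivation F (hoEven F p t) (wittEven F p t))

theorem cf_add (a b : DPS F n) (s : Ind n) : cf D (a + b) s = cf D a s + cf D b s := by
  simp only [cf, map_add, co_add]

theorem cf_smul (c : F) (a : DPS F n) (s : Ind n) : cf D (c • a) s = c • cf D a s := by
  simp only [cf, map_smul, co_smul]

theorem cf_zero (s : Ind n) : cf D 0 s = 0 := by
  simp only [cf, map_zero, co_zero]

/-- The derivation law in coordinates, using [T_H(a), T_H(b)] = T_H(T_H(a) b). All later information
about D is extracted from this identity by choosing a and b. -/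
theorem cf_lie {a b : DPS F n} (ha : a ∈ oddTrunc F p t) (hb : b ∈ oddTrunc F p t) (s : Ind n) :
    cf D (TH F n a b) s = (TH F n a (cf D b s) - vf F n (cf D b) (hc a s)) -
      (TH F n b (cf D a s) - vf F n (cf D a) (hc b s)) := by
  rw [cf, ← hoT_lie ha hb, LieDerivation.apply_lie_eq_sub, co_sub]
  change co ⁅(hoT F p t a : wittEven F p t), D (hoT F p t b)⁆ s -
    co ⁅(hoT F p t b : wittEven F p t), D (hoT F p t a)⁆ s = _
  rw [co_lie, co_lie, vf_co_hoT ha, vf_co_hoT hb, co_hoT ha, co_hoT hb]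
  rfl

theorem cf_sub_adW (E : wittEven F p t) {a : DPS F n} (ha : a ∈ oddTrunc F p t) (s : Ind n) :
    cf (D - adW F p t E) a s =
      cf D a s - (vf F n (co E) (hc a s) - TH F n a (co E s)) := by
  rw [cf, LieDerivation.sub_apply, adW_apply, co_sub, co_lie, vf_co_hoT ha, co_hoT ha]
  rfl

variable {D}

theorem eq_zero_of_cf (h : ∀ b, Adm p t b → ∀ s, cf D (Finsupp.single b 1) s = 0) : D = 0 := by
  refine LieDerivation.ext fun x => ?_
  obtain ⟨a, ha, rfl⟩ := exists_hoT x
  rw [LieDerivation.zero_apply]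
  refine co_ext fun s => ?_
  change cf D a s = 0
  rw [← Finsupp.sum_single a, Finsupp.sum]
  refine Finset.sum_induction _ (fun a => cf D a s = 0) (fun a b h₁ h₂ => ?_) (cf_zero D s)
    fun b hb => ?_
  · rw [cf_add, h₁, h₂, add_zero]
  · rw [← mul_one (a b), ← smul_eq_mul, ← Finsupp.smul_single, cf_smul, h b, smul_zero]
    rw [Finsupp.mem_support_iff] at hb
    exact ⟨coeff_mem_trunc ha.1 hb, coeff_mem_parityPart ha.2 hb⟩

theorem cf_mem_degPart {d : ℤ} (hD : D ∈ derDeg F p t d) {a : DPS F n} (ha : a ∈ oddTrunc F p t)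
    {e : ℤ} (he : a ∈ degPart F n e) (s : Ind n) : cf D a s ∈ degPart F n (d + e - 1) := by
  have := mem_wittEvenDeg.1 (hD _ _ (hoT_mem_deg ha he)) s
  rwa [show d + (e - 2) + 1 = d + e - 1 by ring] at this

end Derivations

/-! ### Derivations and ad-nilpotent elements in characteristic p -/

section Nilpotent

variable {F L M : Type*} [Field F] [LieRing L] [LieAlgebra F L] [AddCommGroup M] [Module F M]
  [LieRingModule L M] [LieModule F L M]

/-- If `ad x` is nilpotent of order `p^k` on the algebra and on the module, then
`x^(p^k - 1) · D(x)` is invariant for every derivation `D`. -/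
theorem lie_toEnd_pow_derivation_eq_zero (p : ℕ) [Fact p.Prime] [CharP F p] (k : ℕ)
    (D : LieDerivation F L M) (x : L) (hL : (LieModule.toEnd F L L x) ^ p ^ k = 0)
    (hM : (LieModule.toEnd F L M x) ^ p ^ k = 0) (y : L) :
    ⁅y, ((LieModule.toEnd F L M x) ^ (p ^ k - 1)) (D x)⁆ = 0 := by
  set A := LieModule.toEnd F L M x with hA
  set B := LieModule.toEnd F L L x with hB
  -- Post- and precomposition with the action of x. They commute, and their difference is the action
  -- of x on Hom(L, M).
  let l : Module.End F (L →ₗ[F] M) := LinearMap.llcomp F L M M A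
  let r : Module.End F (L →ₗ[F] M) := LinearMap.lcomp F M B
  have hl : ∀ m, ∀ f : L →ₗ[F] M, (l ^ m) f = (A ^ m) ∘ₗ f := fun m => by
    induction m with
    | zero => intro f; rfl
    | succ m ih => intro f; rw [pow_succ', Module.End.mul_apply, ih, pow_succ']; rfl
  have hr : ∀ m, ∀ f : L →ₗ[F] M, (r ^ m) f = f ∘ₗ (B ^ m) := fun m => by
    induction m with
    | zero => intro f; rfl
    | succ m ih => intro f; rw [pow_succ', Module.End.mul_apply, ih, pow_succ]; rfl
  have hcomm : Commute l r := LinearMap.ext fun f => LinearMap.ext fun z => rfl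
  have hpow : (l - r) ^ p ^ k = 0 := by
    rcases subsingleton_or_nontrivial (Module.End F (L →ₗ[F] M)) with h | h
    · exact Subsingleton.elim _ _
    · have : CharP (Module.End F (L →ₗ[F] M)) p :=
        charP_of_injective_algebraMap (FaithfulSMul.algebraMap_injective F _) p
      -- Frobenius: (l - r)^(p^k) = l^(p^k) - r^(p^k), and both powers vanish.
      rw [sub_pow_char_pow_of_commute (p := p) (h := hcomm)]
      refine LinearMap.ext fun f => ?_
      rw [LinearMap.sub_apply, hl, hr, hM, hL]
      simp
  -- The action of x turns D into the inner map z ↦ [z, D(x)]; every further application replaces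
  -- the vector by its image under x. The exponent is thus one ahead of that of A, which is why p^k
  -- - 1 appears in the conclusion.
  have hd : ∀ m, ∀ z, ((l - r) ^ (m + 1)) (D : L →ₗ[F] M) z = ⁅z, (A ^ m) (D x)⁆ := fun m => by
    induction m with
    | zero =>
      intro z
      change ⁅x, D z⁆ - D ⁅x, z⁆ = _
      rw [LieDerivation.apply_lie_eq_sub]
      simp
    | succ m ih =>
      intro z
      rw [pow_succ', Module.End.mul_apply]
      change ⁅x, ((l - r) ^ (m + 1)) (D : L →ₗ[F] M) z⁆ -
        ((l - r) ^ (m + 1)) (D : L →ₗ[F] M) ⁅x, z⁆ = _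
      rw [ih, ih, pow_succ', Module.End.mul_apply, hA, LieModule.toEnd_apply_apply, leibniz_lie x z]
      abel
  have h0 : p ^ k ≠ 0 := pow_ne_zero _ (Fact.out : p.Prime).ne_zero
  have := hd (p ^ k - 1) y
  rw [Nat.sub_add_cancel (by omega), hpow] at this
  exact this.symm

end Nilpotent

/-! ### Integration in truncated divided powers -/

section Antiderivative

variable {F : Type*} [Field F] {n : ℕ}

theorem sub_single_add {α : Fin n → ℕ} {i : Fin n} (h : α i ≠ 0) :
    α - Pi.single i 1 + Pi.single i 1 = α := by
  funext j
  rcases eq_or_ne j i with rfl | hj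
  · simp; omega
  · simp [hj]

theorem coeff_eq_pd {f : DPS F n} {i : Fin n} {a : Mono n} (h : a.1 i ≠ 0) :
    f a = pd F n (Sum.inl i) f (a.1 - Pi.single i 1, a.2) := by
  rw [pd_even_apply, sub_single_add h]

theorem pd_pow_apply (i : Fin n) (m : ℕ) (f : DPS F n) (a : Mono n) :
    (pd F n (Sum.inl i) ^ m) f a = f (a.1 + Pi.single i m, a.2) := by
  induction m generalizing a with
  | zero => simp
  | succ m ih =>
    rw [pow_succ', Module.End.mul_apply, pd_even_apply, ih, add_assoc, ← Pi.single_add, add_comm 1]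

/-- A compatible system of partial derivatives without leading terms has an antiderivative. -/
theorem exists_antiderivative {p : ℕ} {t : Fin n → ℕ} (g : Fin n → DPS F n)
    (hg : ∀ i, g i ∈ trunc F p t)
    (hc : ∀ i j, pd F n (Sum.inl i) (g j) = pd F n (Sum.inl j) (g i))
    (ht : ∀ i a, g i a ≠ 0 → a.1 i < p ^ t i - 1) :
    ∃ G : DPS F n, (∀ i, pd F n (Sum.inl i) G = g i) ∧ G ∈ trunc F p t ∧
      ∀ a, G a ≠ 0 → ∃ i, a.1 i ≠ 0 ∧ g i (a.1 - Pi.single i 1, a.2) ≠ 0 := by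
  classical
  -- The coefficient prescribed at a does not depend on the direction used to lower the exponent:
  -- both candidates equal the coefficient of ∂_j g_i = ∂_i g_j with both exponents lowered.
  have hcons : ∀ (a : Mono n) (i j : Fin n), a.1 i ≠ 0 → a.1 j ≠ 0 →
      g i (a.1 - Pi.single i 1, a.2) = g j (a.1 - Pi.single j 1, a.2) := by
    intro a i j hi hj
    rcases eq_or_ne i j with rfl | hij
    · rfl
    have h1 : (a.1 - Pi.single i 1 : Fin n → ℕ) j ≠ 0 := by simpa [hij.symm] using hj
    have h2 : (a.1 - Pi.single j 1 : Fin n → ℕ) i ≠ 0 := by simpa [hij] using hi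
    rw [coeff_eq_pd (i := j) (f := g i) (a := (a.1 - Pi.single i 1, a.2)) h1,
      coeff_eq_pd (i := i) (f := g j) (a := (a.1 - Pi.single j 1, a.2)) h2, hc i j]
    simp only [tsub_right_comm]
  -- The terms without even variables are the constants of integration. Setting them to zero makes
  -- every term of G come from a term of some g_i, so G inherits parity and degree.
  let G0 : Mono n → F := fun a =>
    if h : ∃ i, a.1 i ≠ 0 then g h.choose (a.1 - Pi.single h.choose 1, a.2) else 0
  have hG0 : ∀ (a : Mono n) (i : Fin n), a.1 i ≠ 0 → G0 a = g i (a.1 - Pi.single i 1, a.2) := by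
    intro a i hi
    have h : ∃ i, a.1 i ≠ 0 := ⟨i, hi⟩
    simp only [G0, dif_pos h]
    exact hcons a _ i h.choose_spec hi
  have hG0' : ∀ a, G0 a ≠ 0 → ∃ i, a.1 i ≠ 0 ∧ g i (a.1 - Pi.single i 1, a.2) ≠ 0 := by
    intro a ha
    by_cases h : ∃ i, a.1 i ≠ 0
    · obtain ⟨i, hi⟩ := h
      exact ⟨i, hi, hG0 a i hi ▸ ha⟩
    · simp only [G0, dif_neg h, ne_eq, not_true_eq_false] at ha
  let S : Finset (Mono n) := univ.biUnion fun i =>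
    (g i).support.image fun b => (b.1 + Pi.single i 1, b.2)
  refine ⟨Finsupp.onFinset S G0 fun a ha => ?_, fun i => Finsupp.ext fun a => ?_, ?_, hG0'⟩
  · obtain ⟨i, hi, hga⟩ := hG0' a ha
    refine Finset.mem_biUnion.2 ⟨i, mem_univ i, Finset.mem_image.2
      ⟨_, Finsupp.mem_support_iff.2 hga, ?_⟩⟩
    simp only [sub_single_add hi]
  · rw [pd_even_apply]
    change G0 _ = _
    rw [hG0 _ i (by simp)]
    simp
  · refine (Finsupp.mem_supported F _).2 fun a ha => ?_
    obtain ⟨i, hi, hga⟩ := hG0' a (by simpa using ha)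
    intro j
    rcases eq_or_ne j i with rfl | hj
    -- Integration raises this exponent by one, so the strict bound on g_j is what keeps G
    -- truncated.
    · have := ht j _ hga
      simp only [Pi.sub_apply, Pi.single_eq_same] at this
      omega
    · have := coeff_mem_trunc (hg i) hga j
      simpa [hj] using this

end Antiderivative

/-! ### The centralizer of ℋ𝒪 in 𝒲 -/

section Centralizer

variable {F : Type*} [Field F] {p : ℕ} [CharP F p] {n : ℕ} {t : Fin n → ℕ}

theorem natCast_ne_zero_of_lt (F : Type*) [Field F] {p : ℕ} [CharP F p] {m : ℕ} (h0 : m ≠ 0)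
    (h : m < p) : (m : F) ≠ 0 := fun e =>
  absurd (Nat.le_of_dvd (Nat.pos_of_ne_zero h0) ((CharP.cast_eq_zero_iff F p m).1 e)) (by omega)

/-- A weight-zero term x^u ∂_l with l even would need [l ∈ u] + 1 = 0 in F, impossible as 2 ≠ 0. For
x^u ∂_{l'} the weights say [i ∈ u] = [i = l] for all i, so u = {l}. -/
theorem eq_dg_of_lam_eq_zero (hp : 2 < p) {f : Ind n → DPS F n}
    (hf : ∀ s a, f s a ≠ 0 → a.1 = 0 ∧ ∀ i, lam F i s a = 0) :
    f = dg fun l => f (Sum.inr l) (0, {l}) := by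
  have h2 : (2 : F) ≠ 0 := by exact_mod_cast natCast_ne_zero_of_lt F (p := p) two_ne_zero hp
  funext s
  refine Finsupp.ext fun a => ?_
  rcases s with l | l
  · by_contra h
    obtain ⟨h0, h1⟩ := hf _ a h
    have := h1 l
    simp only [lam, wt, h0, Pi.zero_apply, Nat.cast_zero, sub_zero, if_true, reduceCtorEq,
      if_false] at this
    split_ifs at this
    · exact h2 (by rw [← this]; norm_num)
    · simp at this
  · simp only [dg, var, Finsupp.smul_single, smul_eq_mul, mul_one]
    by_cases ha : a = (0, {l})
    · rw [ha, Finsupp.single_eq_same]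
    · rw [Finsupp.single_eq_of_ne ha]
      by_contra h
      obtain ⟨h0, h1⟩ := hf _ a h
      refine ha (Prod.ext h0 (Finset.ext fun i => ?_))
      have := h1 i
      simp only [lam, wt, h0, Pi.zero_apply, Nat.cast_zero, sub_zero, reduceCtorEq, if_false,
        add_zero, Sum.inr.injEq, eq_comm (a := l)] at this
      rw [Finset.mem_singleton]
      rcases eq_or_ne i l with rfl | h4
      · by_cases h3 : i ∈ a.2 <;> simp [h3] at this ⊢
      · by_cases h3 : i ∈ a.2 <;> simp [h3, h4] at this ⊢

theorem exists_triple (hn : 3 ≤ n) (i : Fin n) : ∃ u : Finset (Fin n), i ∈ u ∧ #u = 3 := by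
  obtain ⟨u, h1, -, h3⟩ := Finset.exists_subsuperset_card_eq (Finset.subset_univ {i})
    (n := 3) (by simp) (by simpa using hn)
  exact ⟨u, h1 (Finset.mem_singleton_self i), h3⟩

theorem hc_odd_single {u : Finset (Fin n)} (hu : #u ≡ 1 [MOD 2]) (s : Ind n) :
    hc (Finsupp.single (0, u) 1 : DPS F n) s = match s with
      | Sum.inl l => -pd F n (Sum.inr l) (Finsupp.single (0, u) 1)
      | Sum.inr _ => 0 := by
  rw [hc_eq (single_mem_parityPart 1 hu)]
  rcases s with l | l
  · simp [par]
  · simp [pd_even_single]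

variable [Fact p.Prime]

/-- The centralizer of `ℋ𝒪` in `𝒲` is trivial. -/
theorem eq_zero_of_centralizes (hp : 2 < p) (hn : 3 ≤ n) (ht : ∀ i, 1 ≤ t i) {V : wittEven F p t}
    (hV : ∀ b, Adm p t b → ∀ s, TH F n (Finsupp.single b 1) (co V s) -
      vf F n (co V) (hc (Finsupp.single b 1) s) = 0) : V = 0 := by
  have h2 : (2 : F) ≠ 0 := by exact_mod_cast natCast_ne_zero_of_lt F (p := p) two_ne_zero hp
  have hq : ∀ i s, pd F n (Sum.inl i) (co V s) = 0 := fun i s => by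
    have := hV (0, {i}) (adm_odd rfl) s
    change TH F n (var (Sum.inr i)) _ - vf F n _ (hc (var (Sum.inr i)) s) = 0 at this
    rwa [TH_var, hc_var, vf_const, sub_zero, neg_eq_zero] at this
  have hco : ∀ s a, co V s a ≠ 0 → a.1 = 0 ∧ ∀ i, lam F i s a = 0 := by
    refine fun s a ha => ⟨funext fun i => ?_, fun i => ?_⟩
    · by_contra h
      rw [coeff_eq_pd h, hq] at ha
      exact ha rfl
    · have := hV _ (adm_single ht i (u := {i}) rfl) s
      have h3 := DFunLike.congr_fun this a
      change (TH F n (xe F i i) (co V s) - vf F n (co V) (hc (xe F i i) s)) a = 0 at h3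
      rw [lie_xe_self_apply] at h3
      exact (mul_eq_zero.1 h3).resolve_right ha
  have hdg := eq_dg_of_lam_eq_zero hp hco
  set c : Fin n → F := fun l => co V (Sum.inr l) (0, {l}) with hc'
  -- The ∂_l-coefficient of the bracket with T_H(x^u) is the field ∑ c_j x_{j'} ∂_{j'} applied to ±
  -- x^{u ∖ l}, an eigenvector with this sum as eigenvalue.
  have hsum : ∀ u : Finset (Fin n), #u = 3 → ∀ l ∈ u, ∑ j ∈ u.erase l, c j = 0 := by
    intro u hu l hl
    have h := hV (0, u) (adm_odd (by rw [hu]; rfl)) (Sum.inl l)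
    rw [hdg, hc_odd_single (by rw [hu]; rfl)] at h
    simp only [dg, map_zero, zero_sub, neg_eq_zero, map_neg, pd_odd_single, if_pos hl,
      vf_dg_single, one_mul] at h
    rw [Finsupp.single_eq_zero, mul_eq_zero] at h
    exact h.resolve_right (wedgeSign_ne_zero (by simp))
  have hc0 : ∀ i, c i = 0 := by
    intro i
    obtain ⟨u, hi, hu⟩ := exists_triple hn i
    -- All c_l with l ∈ u equal their common sum S, whence S = 3S and S = 0.
    have h1 : ∀ l ∈ u, c l = ∑ j ∈ u, c j := fun l hl => by
      rw [← Finset.add_sum_erase u c hl, hsum u hu l hl, add_zero]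
    have h3 : ∑ l ∈ u, c l = 3 * ∑ j ∈ u, c j := by
      conv_lhs => rw [Finset.sum_congr rfl h1]
      rw [Finset.sum_const, hu]
      simp
    have h4 : 2 * ∑ j ∈ u, c j = 0 := by linear_combination -h3
    rw [h1 i hi, (mul_eq_zero.1 h4).resolve_left h2]
  refine co_ext fun s => ?_
  rw [hdg, co_zero]
  rcases s with l | l
  · rfl
  · simp [dg, hc0]

end Centralizer

/-! ### Making D vanish on ℋ𝒪_{-1} and on the torus -/

section Normalization

variable {F : Type*} [Field F] {p : ℕ} [Fact p.Prime] [CharP F p] {n : ℕ} {t : Fin n → ℕ}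
  {D : LieDerivation F (hoEven F p t) (wittEven F p t)}

theorem toEnd_pow_apply (x : hoEven F p t) (m : ℕ) (y : hoEven F p t) :
    ((((LieModule.toEnd F (hoEven F p t) (hoEven F p t) x) ^ m) y : hoEven F p t) :
      wittEven F p t) = ((LieModule.toEnd F (hoEven F p t) (wittEven F p t) x) ^ m) y := by
  induction m with
  | zero => rfl
  | succ m ih =>
    rw [pow_succ', pow_succ', Module.End.mul_apply, Module.End.mul_apply, ← ih]
    rfl

theorem co_lie_var (i : Fin n) (V : wittEven F p t) (s : Ind n) :
    co ⁅hoT F p t (var (Sum.inr i)), V⁆ s = -pd F n (Sum.inl i) (co V s) := by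
  change co ⁅(hoT F p t (var (Sum.inr i)) : wittEven F p t), V⁆ s = _
  rw [co_lie, vf_co_hoT (var_mem_oddTrunc i), TH_var, co_hoT (var_mem_oddTrunc i), hc_var,
    vf_const, sub_zero]

theorem co_toEnd_pow_var (i : Fin n) (m : ℕ) (V : wittEven F p t) (s : Ind n) :
    co (((LieModule.toEnd F (hoEven F p t) (wittEven F p t) (hoT F p t (var (Sum.inr i)))) ^ m) V) s
      = (-1 : F) ^ m • (pd F n (Sum.inl i) ^ m) (co V s) := by
  induction m with
  | zero => simp
  | succ m ih =>
    rw [pow_succ', Module.End.mul_apply, LieModule.toEnd_apply_apply, co_lie_var, ih, map_smul,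
      pow_succ' (pd F n _), Module.End.mul_apply, pow_succ, mul_smul, neg_one_smul, smul_neg]

/-- Up to sign, p^{t_i} brackets with ∂_i shift coefficients by p^{t_i} in the i-th exponent, past
the truncation bound. -/
theorem toEnd_pow_var_eq_zero (i : Fin n) :
    (LieModule.toEnd F (hoEven F p t) (wittEven F p t) (hoT F p t (var (Sum.inr i)))) ^ p ^ t i
      = 0 := by
  refine LinearMap.ext fun V => co_ext fun s => ?_
  rw [co_toEnd_pow_var, LinearMap.zero_apply, co_zero]
  refine (smul_eq_zero_of_right _ (Finsupp.ext fun a => ?_))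
  rw [pd_pow_apply, Finsupp.zero_apply]
  by_contra h
  have := coeff_mem_trunc (co_mem V s).1 h i
  have h0 : 0 < p ^ t i := pow_pos (Fact.out : p.Prime).pos _
  simp only [Pi.add_apply, Pi.single_eq_same] at this
  omega

/-- This removes the obstruction to integration: D(∂_i) has no term with i-th exponent p^{t_i} - 1,
because the iterated bracket isolating these terms is centralized by ℋ𝒪. -/
theorem pd_pow_cf_var (hp : 2 < p) (hn : 3 ≤ n) (ht : ∀ i, 1 ≤ t i)
    (D : LieDerivation F (hoEven F p t) (wittEven F p t)) (i : Fin n) (s : Ind n) :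
    (pd F n (Sum.inl i) ^ (p ^ t i - 1)) (cf D (var (Sum.inr i)) s) = 0 := by
  have hM := toEnd_pow_var_eq_zero (F := F) (p := p) (t := t) i
  have hL : (LieModule.toEnd F (hoEven F p t) (hoEven F p t) (hoT F p t (var (Sum.inr i))))
      ^ p ^ t i = 0 := by
    refine LinearMap.ext fun y => Subtype.ext ?_
    rw [toEnd_pow_apply, hM]
    rfl
  have h := lie_toEnd_pow_derivation_eq_zero p (t i) D _ hL hM
  have h0 := eq_zero_of_centralizes hp hn ht (V := _) fun b hb s => by
    have := congrArg (fun V => co V s) (h (hoT F p t (Finsupp.single b 1)))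
    change co ⁅(hoT F p t (Finsupp.single b 1) : wittEven F p t), _⁆ s = 0 at this
    rwa [co_lie, vf_co_hoT (single_mem_oddTrunc hb 1), co_hoT (single_mem_oddTrunc hb 1)] at this
  have h1 := co_toEnd_pow_var i (p ^ t i - 1) (D (hoT F p t (var (Sum.inr i)))) s
  rw [h0, co_zero] at h1
  exact (smul_eq_zero.1 h1.symm).resolve_left (pow_ne_zero _ (by simp))

theorem cf_mem (D : LieDerivation F (hoEven F p t) (wittEven F p t)) (a : DPS F n) (s : Ind n) :
    cf D a s ∈ trunc F p t ∧ cf D a s ∈ parityPart F n (par s) := co_mem _ s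

theorem var_inr_mem_degPart (i : Fin n) : (var (Sum.inr i) : DPS F n) ∈ degPart F n 1 := by
  have h := single_mem_degPart (F := F) ((0, {i}) : Mono n) 1
  rwa [show ((mdeg ((0, {i}) : Mono n) : ℕ) : ℤ) = 1 by simp [mdeg]] at h

/-- Every derivation of degree `d` agrees with an inner one on `ℋ𝒪_{-1}`. -/
theorem exists_sub_adW_var (hp : 2 < p) (hn : 3 ≤ n) (ht : ∀ i, 1 ≤ t i) {d : ℤ}
    (hD : D ∈ derDeg F p t d) : ∃ E ∈ wittEvenDeg F p t d,
      ∀ i s, cf (D - adW F p t E) (var (Sum.inr i)) s = 0 := by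
  have key : ∀ s : Ind n, ∃ G : DPS F n,
      (∀ i, pd F n (Sum.inl i) G = cf D (var (Sum.inr i)) s) ∧ G ∈ trunc F p t ∧
      ∀ a, G a ≠ 0 → ∃ i, a.1 i ≠ 0 ∧
        cf D (var (Sum.inr i)) s (a.1 - Pi.single i 1, a.2) ≠ 0 := by
    intro s
    refine exists_antiderivative (fun i => cf D (var (Sum.inr i)) s) (fun i => (cf_mem D _ s).1)
      (fun i j => ?_) fun i a ha => ?_
    · have := cf_lie D (var_mem_oddTrunc i) (var_mem_oddTrunc j) s
      rw [TH_var, pd_var, if_neg (by simp), neg_zero, cf_zero, TH_var, TH_var, hc_var, hc_var,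
        vf_const, vf_const] at this
      simp only [sub_zero] at this
      exact neg_injective (sub_eq_zero.1 this.symm)
    · refine lt_of_le_of_ne (coeff_mem_trunc (cf_mem D _ s).1 ha i) fun h => ha ?_
      -- Assuming the i-th exponent of a is maximal, evaluate the vanishing shift where that
      -- exponent is set to zero; this reads off the coefficient at a.
      have h1 := DFunLike.congr_fun (pd_pow_cf_var hp hn ht D i s)
        (a.1 - Pi.single i (a.1 i), a.2)
      rw [← h, pd_pow_apply] at h1
      have h2 : a.1 - Pi.single i (a.1 i) + Pi.single i (a.1 i) = a.1 := by
        funext j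
        rcases eq_or_ne j i with rfl | hj
        · simp
        · simp [hj]
      rwa [h2] at h1
  choose G hG hGt hGs using key
  have hpar : ∀ s, G s ∈ parityPart F n (par s) := fun s =>
    (Finsupp.mem_supported F _).2 fun a ha => by
      obtain ⟨i, hi, h⟩ := hGs s a (by simpa using ha)
      have := coeff_mem_parityPart (cf_mem D _ s).2 h
      exact this
  refine ⟨ofCo G fun s => ⟨hGt s, hpar s⟩, mem_wittEvenDeg.2 fun s => ?_, fun i s => ?_⟩
  · rw [co_ofCo]
    refine (Finsupp.mem_supported F _).2 fun a ha => ?_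
    obtain ⟨i, hi, h⟩ := hGs s a (by simpa using ha)
    have h1 := coeff_mem_degPart
      (cf_mem_degPart hD (var_mem_oddTrunc i) (var_inr_mem_degPart i) s) h
    have h2 := sum_sub_single hi
    simp only [mdeg] at h1
    simp only [Set.mem_ofPred_eq]
    omega
  · rw [cf_sub_adW D _ (var_mem_oddTrunc i), hc_var, vf_const, TH_var, co_ofCo, hG]
    simp

theorem xe_mem_degPart (i j : Fin n) : xe F i j ∈ degPart F n 2 := by
  have h := single_mem_degPart (F := F) ((Pi.single i 1, {j}) : Mono n) 1
  rwa [show ((mdeg ((Pi.single i 1, {j}) : Mono n) : ℕ) : ℤ) = 2 by simp [mdeg]] at h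

theorem TH_xe_self_xe_self (i j : Fin n) : TH F n (xe F i i) (xe F j j) = 0 := by
  rw [xe.eq_def F j j, TH_xe_self_single, wt]
  rcases eq_or_ne i j with rfl | h <;> simp [*]

theorem TH_xe_self_monomial (i : Fin n) (b : Mono n) :
    TH F n (xe F i i) (Finsupp.single b 1) = wt F i b • Finsupp.single b 1 := by
  rw [TH_xe_self_single, Finsupp.smul_single, smul_eq_mul]

/-- The value of a derivation at a torus element that has weight zero vanishes. -/
theorem cf_xe_self_eq_zero (hp : 2 < p) (hn : 3 ≤ n) (ht : ∀ i, 1 ≤ t i) (k : Fin n)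
    (hz : ∀ s a i, lam F i s a * cf D (xe F k k) s a = 0) (s : Ind n) : cf D (xe F k k) s = 0 := by
  have h0 : D (hoT F p t (xe F k k)) = 0 := by
    refine eq_zero_of_centralizes hp hn ht fun b hb s => ?_
    change TH F n _ (cf D (xe F k k) s) - vf F n (cf D (xe F k k)) _ = 0
    have hb' := single_mem_oddTrunc (F := F) hb 1
    have hk := xe_mem_oddTrunc (F := F) (p := p) ht k k
    have h1 := cf_lie D hk hb' s
    rw [TH_xe_self_monomial, cf_smul] at h1
    -- Since h_k commutes with D(h_k), the bracket X = [T_H(x^b), D(h_k)] has the same h_k-weight as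
    -- T_H(x^b).
    have hz' : ⁅(hoT F p t (xe F k k) : wittEven F p t), D (hoT F p t (xe F k k))⁆ = 0 :=
      co_ext fun s => by
        rw [co_lie, vf_co_hoT hk, co_hoT hk, co_zero]
        exact Finsupp.ext fun a => (lie_xe_self_apply k (cf D (xe F k k)) s a).trans (hz s a k)
    have h2 : ⁅(hoT F p t (xe F k k) : wittEven F p t),
        ⁅(hoT F p t (Finsupp.single b 1) : wittEven F p t), D (hoT F p t (xe F k k))⁆⁆ =
        wt F k b • ⁅(hoT F p t (Finsupp.single b 1) : wittEven F p t),
          D (hoT F p t (xe F k k))⁆ := by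
      rw [leibniz_lie, hz', lie_zero, add_zero]
      have : ⁅(hoT F p t (xe F k k) : wittEven F p t),
          (hoT F p t (Finsupp.single b 1) : wittEven F p t)⁆ =
          ((wt F k b • hoT F p t (Finsupp.single b 1) : hoEven F p t) : wittEven F p t) := by
        rw [← map_smul, ← TH_xe_self_monomial, ← hoT_lie hk hb']
        rfl
      rw [this]
      exact smul_lie (wt F k b) (hoT F p t (Finsupp.single b 1) : wittEven F p t) _
    set X := ⁅(hoT F p t (Finsupp.single b 1) : wittEven F p t), D (hoT F p t (xe F k k))⁆ with hX
    have hXs : co X s = TH F n (Finsupp.single b 1) (cf D (xe F k k) s) -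
        vf F n (cf D (xe F k k)) (hc (Finsupp.single b 1) s) := by
      rw [hX, co_lie, vf_co_hoT hb', co_hoT hb']; rfl
    rw [← hXs]
    refine Finsupp.ext fun a => ?_
    have h3 : lam F k s a * co X s a = wt F k b * co X s a := by
      have := DFunLike.congr_fun (congrArg (fun V => co V s) h2) a
      simp only [co_lie, vf_co_hoT hk, co_hoT hk, lie_xe_self_apply, co_smul, Finsupp.smul_apply,
        smul_eq_mul] at this
      exact this
    have h4 : wt F k b * cf D (Finsupp.single b 1) s a =
        lam F k s a * cf D (Finsupp.single b 1) s a - co X s a := by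
      have := DFunLike.congr_fun h1 a
      rw [← hXs, Finsupp.sub_apply, lie_xe_self_apply, Finsupp.smul_apply, smul_eq_mul] at this
      exact this
    rw [Finsupp.zero_apply]
    -- At equal weights the D(T_H(x^b)) terms of the derivation law cancel and leave the coefficient
    -- of X as zero. At different weights X has no coefficient, being a weight vector.
    by_cases h : lam F k s a = wt F k b
    · rw [h] at h4; linear_combination h4
    · exact (mul_eq_zero.1 (show (lam F k s a - wt F k b) * co X s a = 0 by
        linear_combination h3)).resolve_left (sub_ne_zero.2 h)
  rw [cf, h0, co_zero]

/-- A derivation that vanishes on `ℋ𝒪_{-1}` agrees with an inner one, which vanishes on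
`ℋ𝒪_{-1}`, on the torus of `ℋ𝒪`. -/
theorem exists_sub_adW_torus (hp : 2 < p) (hn : 3 ≤ n) (ht : ∀ i, 1 ≤ t i) {d : ℤ}
    (hD : D ∈ derDeg F p t d) (hq : ∀ i s, cf D (var (Sum.inr i)) s = 0) :
    ∃ E ∈ wittEvenDeg F p t d,
      (∀ i s, cf (D - adW F p t E) (var (Sum.inr i)) s = 0) ∧
      ∀ i s, cf (D - adW F p t E) (xe F i i) s = 0 := by
  classical
  have hx : ∀ i, xe F i i ∈ oddTrunc F p t := fun i => xe_mem_oddTrunc ht i i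
  -- [∂_i, h_k] is zero or a multiple of ∂_k, so D kills it. The corrected field built from the
  -- D(h_k) therefore has coefficients killed by ∂_i, and subtracting its ad preserves the vanishing
  -- on ℋ𝒪_{-1}.
  have hpd : ∀ i k s, pd F n (Sum.inl i) (cf D (xe F k k) s) = 0 := by
    intro i k s
    have h := cf_lie D (var_mem_oddTrunc i) (hx k) s
    have h1 : vf F n (cf D (var (Sum.inr i))) = 0 := by
      rw [show cf D (var (Sum.inr i)) = 0 from funext (hq i), map_zero]
    rw [TH_var, TH_var, hc_var, vf_const, hq, map_zero, h1, LinearMap.zero_apply, pd_xe] at h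
    have h2 : cf D (-(if (Sum.inl i : Ind n) = Sum.inl k then var (Sum.inr k) else
        if (Sum.inl i : Ind n) = Sum.inr k then var (Sum.inl k) else 0)) s = 0 := by
      rw [← neg_one_smul F, cf_smul]
      by_cases hik : i = k
      · simp [hik, hq]
      · simp [hik, cf_zero]
    rw [h2] at h
    simpa using h
  -- D applied to [h_i, h_j] = 0.
  have hcomm : ∀ i j s a, lam F i s a * cf D (xe F j j) s a =
      lam F j s a * cf D (xe F i i) s a := by
    intro i j s a
    have h := cf_lie D (hx i) (hx j) s
    rw [TH_xe_self_xe_self, cf_zero] at h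
    have := DFunLike.congr_fun h a
    rw [Finsupp.sub_apply, lie_xe_self_apply, lie_xe_self_apply] at this
    exact (sub_eq_zero.1 this.symm)
  -- Solves λ_i e = -D(h_i) using any i with λ_i ≠ 0; by `hcomm` the choice is immaterial. Where all
  -- weights vanish nothing can be divided, and e is 0.
  let e0 : Ind n → Mono n → F := fun s a =>
    if h : ∃ i, lam F i s a ≠ 0 then -((lam F h.choose s a)⁻¹ * cf D (xe F h.choose h.choose) s a)
    else 0
  have he0 : ∀ s a i, lam F i s a ≠ 0 → lam F i s a * e0 s a = -cf D (xe F i i) s a := by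
    intro s a i hi
    have h : ∃ i, lam F i s a ≠ 0 := ⟨i, hi⟩
    have h1 := h.choose_spec
    simp only [e0, dif_pos h]
    have h2 := hcomm i h.choose s a
    field_simp
    linear_combination -h2
  have hsupp : ∀ s a, e0 s a ≠ 0 → ∃ i, cf D (xe F i i) s a ≠ 0 := by
    intro s a ha
    by_cases h : ∃ i, lam F i s a ≠ 0
    · refine ⟨h.choose, fun h0 => ha ?_⟩
      simp only [e0, dif_pos h, h0, mul_zero, neg_zero]
    · simp only [e0, dif_neg h, ne_eq, not_true_eq_false] at ha
  let E0 : Ind n → DPS F n := fun s => Finsupp.onFinset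
    (univ.biUnion fun i => (cf D (xe F i i) s).support) (e0 s) fun a ha => by
      obtain ⟨i, hi⟩ := hsupp s a ha
      exact Finset.mem_biUnion.2 ⟨i, mem_univ i, Finsupp.mem_support_iff.2 hi⟩
  have hE0 : ∀ s a, a ∈ ((E0 s).support : Set (Mono n)) → ∃ i, cf D (xe F i i) s a ≠ 0 :=
    fun s a ha => hsupp s a (Finsupp.mem_support_iff.1 (Finset.mem_coe.1 ha))
  have hE : ∀ s, E0 s ∈ trunc F p t ∧ E0 s ∈ parityPart F n (par s) := by
    refine fun s => ⟨(Finsupp.mem_supported F _).2 fun a ha => ?_,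
      (Finsupp.mem_supported F _).2 fun a ha => ?_⟩
    · obtain ⟨i, hi⟩ := hE0 s a ha
      exact coeff_mem_trunc (cf_mem D _ s).1 hi
    · obtain ⟨i, hi⟩ := hE0 s a ha
      exact coeff_mem_parityPart (cf_mem D _ s).2 hi
  have hdeg : ofCo E0 hE ∈ wittEvenDeg F p t d := by
    refine mem_wittEvenDeg.2 fun s => ?_
    rw [co_ofCo]
    refine (Finsupp.mem_supported F _).2 fun a ha => ?_
    obtain ⟨i, hi⟩ := hE0 s a ha
    have := coeff_mem_degPart (cf_mem_degPart hD (hx i) (xe_mem_degPart i i) s) hi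
    simp only [mdeg] at this
    simp only [Set.mem_ofPred_eq]
    omega
  refine ⟨ofCo E0 hE, hdeg, fun i s => ?_, fun i s => ?_⟩
  · rw [cf_sub_adW D _ (var_mem_oddTrunc i), hq, hc_var, vf_const, TH_var, co_ofCo]
    have : pd F n (Sum.inl i) (E0 s) = 0 := Finsupp.ext fun a => by
      rw [pd_even_apply, Finsupp.zero_apply]
      by_contra h
      obtain ⟨k, hk⟩ := hsupp s _ h
      have := DFunLike.congr_fun (hpd i k s) a
      rw [pd_even_apply] at this
      exact hk this
    simp [this]
  · refine cf_xe_self_eq_zero hp hn ht i (fun s a j => ?_) s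
    have h1 : cf (D - adW F p t (ofCo E0 hE)) (xe F i i) s a =
        cf D (xe F i i) s a + lam F i s a * e0 s a := by
      have h2 : (fun s => co (ofCo E0 hE) s) = E0 := funext fun s => co_ofCo E0 hE s
      have h3 := lie_xe_self_apply i (co (ofCo E0 hE)) s a
      rw [cf_sub_adW D _ (hx i), Finsupp.sub_apply, ← neg_sub (TH F n _ _), Finsupp.neg_apply, h3,
        co_ofCo]
      change _ - -(lam F i s a * e0 s a) = _
      ring
    rw [h1]
    -- The remainder is zero where λ_i ≠ 0. Where λ_i = 0 it is D(h_i), and λ_j D(h_i) = λ_i D(h_j)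
    -- = 0. So it has weight zero throughout.
    by_cases hi : lam F i s a = 0
    · rw [hi, zero_mul, add_zero, hcomm j i, hi, zero_mul]
    · rw [he0 s a i hi, add_neg_cancel, mul_zero]

end Normalization

/-! ### Weights modulo p against degrees in ℤ -/

section Weights

/-- If the weight difference is pk, the bounded quantity equals pk - 2a = 2(e + δ - ε) - pk. For k =
0 it is -2a; for k ≥ 1 it is at most 4 - p, negative exactly because p ≥ 5; k < 0 is impossible. -/
theorem weight_bound_even {p e δ ε a : ℤ} (hp : 5 ≤ p) (he : 0 ≤ e ∧ e ≤ 1) (hδ : 0 ≤ δ ∧ δ ≤ 1)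
    (hε : 0 ≤ ε ∧ ε ≤ 1) (ha : 0 ≤ a) (h : p ∣ e + δ - (ε - a)) :
    e + δ - a - ε ≤ 0 ∧ (a ≠ 0 → e + δ - a - ε ≤ -1) := by
  obtain ⟨k, hk⟩ := h
  rcases lt_trichotomy k 0 with h0 | rfl | h0
  · have : p * k ≤ -p := by nlinarith
    omega
  · omega
  · have : p ≤ p * k := by nlinarith
    omega

/-- Again the value is -2a for k = 0, while for k ≥ 1 it is 2(e - δ - ε) - pk ≤ 2 - p ≤ -3. -/
theorem weight_bound_odd {p e δ ε a : ℤ} (hp : 5 ≤ p) (he : 0 ≤ e ∧ e ≤ 1) (hδ : 0 ≤ δ ∧ δ ≤ 1)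
    (hε : 0 ≤ ε ∧ ε ≤ 1) (ha : 0 ≤ a) (h : p ∣ e - δ - (ε - a)) :
    e - δ - a - ε ≤ 0 ∧ (a ≠ 0 → e - δ - a - ε ≤ -2) ∧ (2 ≤ a → e - δ - a - ε ≤ -3) := by
  obtain ⟨k, hk⟩ := h
  rcases lt_trichotomy k 0 with h0 | rfl | h0
  · have : p * k ≤ -p := by nlinarith
    omega
  · omega
  · have : p ≤ p * k := by nlinarith
    omega

theorem indicator_bound (P : Prop) [Decidable P] :
    (0 : ℤ) ≤ (if P then 1 else 0) ∧ (if P then 1 else 0 : ℤ) ≤ 1 := by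
  split_ifs <;> simp

variable {F : Type*} [Field F] {p : ℕ} [CharP F p] {n : ℕ}

theorem eq_zero_of_weight_even (hp : 5 ≤ p) {a b : Mono n} {l : Fin n} {d : ℤ} (hd : 0 ≤ d)
    (ha : a.1 = 0) (hw : ∀ i, lam F i (Sum.inl l) a = wt F i b)
    (hdeg : (mdeg a : ℤ) + 1 = mdeg b + d) : b.1 = 0 ∧ d = 0 := by
  -- The contribution of the i-th pair of variables to the degree shift, so that ∑ x_i = d ≥ 0. The
  -- weights force each x_i ≤ 0, hence equality everywhere.
  let x : Fin n → ℤ := fun i => (if i ∈ a.2 then 1 else 0) + (if i = l then 1 else 0) - (b.1 i : ℤ) -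
    (if i ∈ b.2 then 1 else 0)
  have hx : ∀ i, x i ≤ 0 ∧ ((b.1 i : ℤ) ≠ 0 → x i ≤ -1) := fun i => by
    refine weight_bound_even (p := p) (by exact_mod_cast hp) (indicator_bound _)
      (indicator_bound _) (indicator_bound _) (Int.natCast_nonneg _) ?_
    have := sub_eq_zero.2 (hw i)
    rw [← CharP.intCast_eq_zero_iff F p]
    simp only [lam, wt, ha, Pi.zero_apply, Nat.cast_zero, sub_zero, Sum.inl.injEq, reduceCtorEq,
      if_false, eq_comm (a := l)] at this
    push_cast
    exact this
  have hsum : ∑ i, x i = d := by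
    simp only [x, Finset.sum_add_distrib, Finset.sum_sub_distrib, Finset.sum_ite_mem,
      Finset.sum_ite_eq', Finset.univ_inter, Finset.mem_univ, if_true, Finset.sum_const,
      nsmul_eq_mul, mul_one]
    simp only [mdeg, ha, Pi.zero_apply, Finset.sum_const_zero, zero_add] at hdeg
    push_cast at hdeg
    linarith
  have hle : ∑ i, x i ≤ 0 := Finset.sum_nonpos fun i _ => (hx i).1
  have h0 := (Finset.sum_eq_zero_iff_of_nonpos fun i _ => (hx i).1).1 (le_antisymm hle (hsum ▸ hd))
  refine ⟨funext fun i => ?_, by linarith⟩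
  by_contra h
  have h1 := (hx i).2 (by exact_mod_cast h)
  have h2 := h0 i (mem_univ i)
  omega

theorem eq_single_of_weight_odd (hp : 5 ≤ p) {a b : Mono n} {l : Fin n} {d : ℤ} (hd : 0 ≤ d)
    (ha : a.1 = 0) (hw : ∀ i, lam F i (Sum.inr l) a = wt F i b)
    (hdeg : (mdeg a : ℤ) + 1 = mdeg b + d) (hpa : #a.2 ≡ 1 [MOD 2]) (hpb : #b.2 ≡ 1 [MOD 2]) :
    d = 0 ∧ ∃ j, b.1 = Pi.single j 1 := by
  let x : Fin n → ℤ := fun i => (if i ∈ a.2 then 1 else 0) - (if i = l then 1 else 0) - (b.1 i : ℤ) -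
    (if i ∈ b.2 then 1 else 0)
  have hx : ∀ i, x i ≤ 0 ∧ ((b.1 i : ℤ) ≠ 0 → x i ≤ -2) ∧ (2 ≤ (b.1 i : ℤ) → x i ≤ -3) :=
    fun i => by
      refine weight_bound_odd (p := p) (by exact_mod_cast hp) (indicator_bound _)
        (indicator_bound _) (indicator_bound _) (Int.natCast_nonneg _) ?_
      have := sub_eq_zero.2 (hw i)
      rw [← CharP.intCast_eq_zero_iff F p]
      simp only [lam, wt, ha, Pi.zero_apply, Nat.cast_zero, sub_zero, Sum.inr.injEq, reduceCtorEq,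
        if_false, add_zero, eq_comm (a := l)] at this
      push_cast
      exact this
  have hsum : ∑ i, x i = d - 2 := by
    simp only [x, Finset.sum_sub_distrib, Finset.sum_ite_mem,
      Finset.sum_ite_eq', Finset.univ_inter, Finset.mem_univ, if_true, Finset.sum_const,
      nsmul_eq_mul, mul_one]
    simp only [mdeg, ha, Pi.zero_apply, Finset.sum_const_zero, zero_add] at hdeg
    push_cast at hdeg
    linarith
  -- If b had no even variables, every x_i would be divisible by p with |x_i| ≤ 2, so ∑ x_i = 0 and
  -- d = 2. Then |a| = |b| + 1, contradicting that both are odd. Given some b_j ≠ 0, the bound x_j ≤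
  -- -2 exhausts the total d - 2 ≥ -2.
  have hne : ∃ j, b.1 j ≠ 0 := by
    by_contra! h
    have hb : ∑ i, b.1 i = 0 := Finset.sum_eq_zero fun i _ => h i
    have hle : ∑ i, x i ≤ 0 := Finset.sum_nonpos fun i _ => (hx i).1
    have hge : ∑ i, x i = 0 := Finset.sum_eq_zero fun i _ => ?_
    · simp only [mdeg, ha, Pi.zero_apply, Finset.sum_const_zero, zero_add, hb] at hdeg
      have h1 : #a.2 % 2 = 1 := hpa
      have h2 : #b.2 % 2 = 1 := hpb
      omega
    · have h1 := sub_eq_zero.2 (hw i)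
      simp only [lam, wt, ha, h i, Pi.zero_apply, Nat.cast_zero, sub_zero, Sum.inr.injEq,
        reduceCtorEq, if_false, add_zero, eq_comm (a := l)] at h1
      have h2 : ((x i : ℤ) : F) = 0 := by
        simp only [x, h i]
        push_cast
        rw [sub_zero]
        exact h1
      rw [CharP.intCast_eq_zero_iff F p] at h2
      refine Int.eq_zero_of_abs_lt_dvd h2 (abs_lt.2 ?_)
      have e1 := indicator_bound (i ∈ a.2)
      have e2 := indicator_bound (i = l)
      have e3 := indicator_bound (i ∈ b.2)
      simp only [x, h i]
      omega
  obtain ⟨j, hj⟩ := hne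
  have hsplit := Finset.add_sum_erase univ x (mem_univ j)
  have hrest : ∑ i ∈ univ.erase j, x i ≤ 0 := Finset.sum_nonpos fun i _ => (hx i).1
  have hj1 := (hx j).2.1 (by exact_mod_cast hj)
  have hj2 := (hx j).2.2
  have h0 := (Finset.sum_eq_zero_iff_of_nonpos (s := univ.erase j) fun i _ => (hx i).1).1
    (by omega)
  refine ⟨by omega, j, funext fun i => ?_⟩
  rcases eq_or_ne i j with rfl | hij
  · rw [Pi.single_eq_same]
    omega
  · rw [Pi.single_eq_of_ne hij]
    by_contra h
    have h1 := (hx i).2.1 (by exact_mod_cast h)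
    have h2 := h0 i (Finset.mem_erase.2 ⟨hij, mem_univ i⟩)
    omega

end Weights

/-! ### Reduction to the monomials x^u and x_j x^u -/

section Vanishing

variable {F : Type*} [Field F] {p : ℕ} [Fact p.Prime] [CharP F p] {n : ℕ} {t : Fin n → ℕ}
  {D : LieDerivation F (hoEven F p t) (wittEven F p t)} {d : ℤ}

/-- Once D kills ∂_i and the lower monomials, D(T_H(x^b)) commutes with all ∂_i, so its coefficients
involve odd variables only. Once D kills the torus, it preserves weights. -/
theorem cf_coeff_of_lower (ht : ∀ i, 1 ≤ t i) (hD : D ∈ derDeg F p t d)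
    (hq : ∀ i s, cf D (var (Sum.inr i)) s = 0) (hx : ∀ i s, cf D (xe F i i) s = 0) {b : Mono n}
    (hb : Adm p t b)
    (hlow : ∀ i, b.1 i ≠ 0 → ∀ s, cf D (Finsupp.single (b.1 - Pi.single i 1, b.2) 1) s = 0)
    {s : Ind n} {a : Mono n} (h : cf D (Finsupp.single b 1) s a ≠ 0) :
    a.1 = 0 ∧ (∀ i, lam F i s a = wt F i b) ∧ (mdeg a : ℤ) + 1 = mdeg b + d ∧
      #a.2 ≡ par s [MOD 2] := by
  have hb' := single_mem_oddTrunc (F := F) hb 1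
  refine ⟨funext fun i => ?_, fun i => ?_, ?_, coeff_mem_parityPart (cf_mem D _ s).2 h⟩
  · by_contra h0
    have h1 := cf_lie D (var_mem_oddTrunc i) hb' s
    have h2 : vf F n (cf D (var (Sum.inr i))) = 0 := by
      rw [show cf D (var (Sum.inr i)) = 0 from funext (hq i), map_zero]
    rw [TH_var, TH_var, hc_var, vf_const, hq, map_zero, h2, LinearMap.zero_apply] at h1
    have h3 : cf D (-pd F n (Sum.inl i) (Finsupp.single b 1)) s = 0 := by
      rw [← neg_one_smul F, cf_smul, pd_even_single]
      split_ifs with h4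
      · rw [cf_zero, smul_zero]
      · rw [hlow i h4, smul_zero]
    rw [h3] at h1
    rw [coeff_eq_pd h0] at h
    simp only [sub_zero, zero_eq_neg] at h1
    rw [h1] at h
    exact h rfl
  · have h1 := cf_lie D (xe_mem_oddTrunc ht i i) hb' s
    have h2 : vf F n (cf D (xe F i i)) = 0 := by
      rw [show cf D (xe F i i) = 0 from funext (hx i), map_zero]
    rw [TH_xe_self_monomial, cf_smul, h2, hx, map_zero, LinearMap.zero_apply, sub_zero,
      sub_zero] at h1
    have h3 := DFunLike.congr_fun h1 a
    rw [lie_xe_self_apply, Finsupp.smul_apply, smul_eq_mul] at h3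
    exact (mul_right_cancel₀ h h3).symm
  · have := coeff_mem_degPart (cf_mem_degPart hD hb' (single_mem_degPart b 1) s) h
    omega

theorem cf_coeff_weight (hp : 5 ≤ p) (ht : ∀ i, 1 ≤ t i) (hd : 0 ≤ d) (hD : D ∈ derDeg F p t d)
    (hq : ∀ i s, cf D (var (Sum.inr i)) s = 0) (hx : ∀ i s, cf D (xe F i i) s = 0) {b : Mono n}
    (hb : Adm p t b)
    (hlow : ∀ i, b.1 i ≠ 0 → ∀ s, cf D (Finsupp.single (b.1 - Pi.single i 1, b.2) 1) s = 0)
    {s : Ind n} {a : Mono n} (h : cf D (Finsupp.single b 1) s a ≠ 0) :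
    d = 0 ∧ ((b.1 = 0 ∧ ∃ l, s = Sum.inl l) ∨ ((∃ j, b.1 = Pi.single j 1) ∧ ∃ l, s = Sum.inr l)) := by
  obtain ⟨h1, h2, h3, h4⟩ := cf_coeff_of_lower ht hD hq hx hb hlow h
  rcases s with l | l
  · obtain ⟨h5, h6⟩ := eq_zero_of_weight_even hp hd h1 h2 h3
    exact ⟨h6, Or.inl ⟨h5, l, rfl⟩⟩
  · obtain ⟨h5, h6⟩ := eq_single_of_weight_odd hp hd h1 h2 h3 h4 hb.2
    exact ⟨h5, Or.inr ⟨h6, l, rfl⟩⟩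

/-- A derivation that vanishes on `ℋ𝒪_{-1}` and on the torus, and, if its degree is zero, on the
`T_H(x^u)` and `T_H(x_j x^u)`, is zero. -/
theorem eq_zero_of_low (hp : 5 ≤ p) (ht : ∀ i, 1 ≤ t i) (hd : 0 ≤ d) (hD : D ∈ derDeg F p t d)
    (hq : ∀ i s, cf D (var (Sum.inr i)) s = 0) (hx : ∀ i s, cf D (xe F i i) s = 0)
    (h0 : d = 0 → ∀ u, #u ≡ 1 [MOD 2] → ∀ s, cf D (Finsupp.single (0, u) 1) s = 0)
    (h1 : d = 0 → ∀ j u, #u ≡ 1 [MOD 2] → ∀ s, cf D (Finsupp.single (Pi.single j 1, u) 1) s = 0) :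
    D = 0 := by
  refine eq_zero_of_cf fun b hb => ?_
  induction hm : ∑ i, b.1 i using Nat.strong_induction_on generalizing b with
  | _ m ih =>
    intro s
    refine Finsupp.ext fun a => ?_
    rw [Finsupp.zero_apply]
    by_contra h
    have hlow : ∀ i, b.1 i ≠ 0 → ∀ s,
        cf D (Finsupp.single (b.1 - Pi.single i 1, b.2) 1) s = 0 := fun i hi => by
      have := sum_sub_single hi
      exact ih (∑ j, (b.1 - Pi.single i 1 : Fin n → ℕ) j) (by omega) _ (hb.sub_single i) rfl
    obtain ⟨h2, ⟨h3, -⟩ | ⟨⟨j, h3⟩, -⟩⟩ := cf_coeff_weight hp ht hd hD hq hx hb hlow h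
    · have := h0 h2 b.2 hb.2 s
      rw [← h3] at this
      exact h (by rw [this]; rfl)
    · have := h1 h2 j b.2 hb.2 s
      rw [← h3] at this
      exact h (by rw [this]; rfl)

/-- The kernel of a derivation is a subalgebra. -/
theorem cf_TH_eq_zero {a b : DPS F n} (ha : a ∈ oddTrunc F p t) (hb : b ∈ oddTrunc F p t)
    (ha0 : ∀ s, cf D a s = 0) (hb0 : ∀ s, cf D b s = 0) (s : Ind n) : cf D (TH F n a b) s = 0 := by
  rw [cf_lie D ha hb, ha0, hb0, show cf D a = 0 from funext ha0,
    show cf D b = 0 from funext hb0]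
  simp

theorem cf_single_eq_zero {a b m : Mono n} {c : F} (ha : Adm p t a) (hb : Adm p t b) (hc : c ≠ 0)
    (h : TH F n (Finsupp.single a 1) (Finsupp.single b 1) = Finsupp.single m c)
    (ha0 : ∀ s, cf D (Finsupp.single a 1) s = 0) (hb0 : ∀ s, cf D (Finsupp.single b 1) s = 0)
    (s : Ind n) : cf D (Finsupp.single m 1) s = 0 := by
  have h1 := cf_TH_eq_zero (single_mem_oddTrunc ha 1) (single_mem_oddTrunc hb 1) ha0 hb0 s
  rw [h, ← mul_one c, ← smul_eq_mul, ← Finsupp.smul_single, cf_smul] at h1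
  exact (smul_eq_zero.1 h1).resolve_left hc

end Vanishing

/-! ### Derivations of degree zero -/

section DegreeZero

variable {F : Type*} [Field F] {n : ℕ}

theorem pd_even_var_inr (i j : Fin n) : pd F n (Sum.inl i) (var (Sum.inr j)) = 0 := by
  rw [pd_var, if_neg (by simp)]

theorem TH_xe_var_inr (i j l : Fin n) :
    TH F n (xe F i j) (var (Sum.inr l)) = if l = i then var (Sum.inr j) else 0 := by
  rw [TH_xe, pd_even_var_inr, map_zero, sub_zero, pd_var]
  by_cases h : l = i
  · rw [if_pos h, if_pos (by rw [h]), mul_one']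
  · rw [if_neg h, if_neg (by simpa using fun e => h e.symm), map_zero]

theorem TH_xe_xe (i j k : Fin n) :
    TH F n (xe F i j) (xe F j k) = (if k = i then xe F j j else 0) - xe F i k := by
  rw [TH_xe, pd_xe, pd_xe]
  have h1 : mul F n (var (Sum.inl i)) (var (Sum.inr k)) = xe F i k := by
    simp [var, xe, mul_single, mulCoeff, wedgeSign]
  have h2 : mul F n (var (Sum.inr j)) (var (Sum.inl j)) = xe F j j := by
    simp [var, xe, mul_single, mulCoeff, wedgeSign]
  by_cases h : k = i
  · subst h; simp [h1, h2]
  · simp [h1, h, eq_comm (a := i)]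

theorem dg_mem {p : ℕ} {t : Fin n → ℕ} (b : Fin n → F) (s : Ind n) :
    dg b s ∈ trunc F p t ∧ dg b s ∈ parityPart F n (par s) := by
  rcases s with l | l
  · exact ⟨zero_mem _, zero_mem _⟩
  · exact ⟨Submodule.smul_mem _ _ (var_mem_oddTrunc l).1,
      Submodule.smul_mem _ _ (var_mem_oddTrunc (p := p) (t := t) l).2⟩

theorem lie_dg_var (b : Fin n → F) (i : Fin n) (s : Ind n) :
    vf F n (dg b) (hc (var (Sum.inr i)) s) - TH F n (var (Sum.inr i)) (dg b s) = 0 := by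
  rw [hc_var, vf_const, TH_var]
  rcases s with l | l
  · simp [dg]
  · simp [dg, pd_even_var_inr]

/-- These are the coboundaries b_j - b_i against which the cocycle of D on ℋ𝒪_0 is matched. -/
theorem lie_dg_xe (b : Fin n → F) (i j : Fin n) (s : Ind n) :
    vf F n (dg b) (hc (xe F i j) s) - TH F n (xe F i j) (dg b s) =
      if s = Sum.inr i then (b j - b i) • var (Sum.inr j) else 0 := by
  rw [hc_xe]
  rcases s with l | l
  · by_cases h : l = j
    · simp [h, dg, vf_var]
    · simp [h, dg]
  · simp only [dg, map_smul, TH_xe_var_inr]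
    by_cases h : l = i
    · simp [h, vf_var, dg, sub_smul]
    · simp [h]

theorem lie_dg_odd_single (b : Fin n → F) {u : Finset (Fin n)} (hu : #u ≡ 1 [MOD 2]) (s : Ind n) :
    vf F n (dg b) (hc (Finsupp.single (0, u) 1) s) - TH F n (Finsupp.single (0, u) 1) (dg b s) =
      match s with
      | Sum.inl l => -(∑ j ∈ u.erase l, b j) • pd F n (Sum.inr l) (Finsupp.single (0, u) 1)
      | Sum.inr _ => 0 := by
  rw [hc_odd_single hu]
  rcases s with l | l
  · simp only [dg, map_zero, sub_zero, map_neg, pd_odd_single]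
    split_ifs
    · rw [vf_dg_single, Finsupp.smul_single, ← Finsupp.single_neg, smul_eq_mul, neg_mul]
    · simp
  · simp only [dg, map_zero, map_smul, var, zero_sub]
    rw [TH_odd_single hu rfl]
    simp [pd_even_single]

variable {p : ℕ} [Fact p.Prime] [CharP F p] {t : Fin n → ℕ}
  {D : LieDerivation F (hoEven F p t) (wittEven F p t)}

theorem dg_mem_deg (b : Fin n → F) :
    ofCo (p := p) (t := t) (dg b) (dg_mem b) ∈ wittEvenDeg F p t 0 := by
  refine mem_wittEvenDeg.2 fun s => ?_
  rw [co_ofCo]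
  rcases s with l | l
  · exact zero_mem _
  · exact Submodule.smul_mem _ _ (var_inr_mem_degPart l)

theorem cf_sub_dg (b : Fin n → F) {a : DPS F n} (ha : a ∈ oddTrunc F p t) (s : Ind n) :
    cf (D - adW F p t (ofCo (dg b) (dg_mem b))) a s =
      cf D a s - (vf F n (dg b) (hc a s) - TH F n a (dg b s)) := by
  rw [cf_sub_adW D _ ha, co_ofCo, show co (ofCo (p := p) (t := t) (dg b) (dg_mem b)) = dg b from
    funext fun s => co_ofCo _ _ s]

/-- A derivation of degree zero that vanishes on `ℋ𝒪_{-1}` and on the torus agrees with an inner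
one on `ℋ𝒪_0`. -/
theorem exists_sub_adW_zero (hp : 5 ≤ p) (hn : 0 < n) (ht : ∀ i, 1 ≤ t i)
    (hD : D ∈ derDeg F p t 0) (hq : ∀ i s, cf D (var (Sum.inr i)) s = 0)
    (hx : ∀ i s, cf D (xe F i i) s = 0) : ∃ E ∈ wittEvenDeg F p t 0,
      (∀ i s, cf (D - adW F p t E) (var (Sum.inr i)) s = 0) ∧
      ∀ i j s, cf (D - adW F p t E) (xe F i j) s = 0 := by
  let q : Fin n → Fin n → F := fun i j => cf D (xe F i j) (Sum.inr i) (0, {j})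
  have hqd : ∀ i, q i i = 0 := fun i => by simp [q, hx]
  have hcf : ∀ i j s, cf D (xe F i j) s =
      if s = Sum.inr i then q i j • var (Sum.inr j) else 0 := by
    intro i j s
    rcases eq_or_ne i j with rfl | hij
    · rw [hx, hqd]; simp
    have hb : Adm p t (Pi.single i 1, {j}) := adm_single ht i rfl
    have hlow : ∀ k, (Pi.single i 1 : Fin n → ℕ) k ≠ 0 → ∀ s,
        cf D (Finsupp.single (Pi.single i 1 - Pi.single k 1, {j}) 1) s = 0 := by
      intro k hk s
      have : k = i := by
        by_contra h
        exact hk (Pi.single_eq_of_ne h 1)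
      rw [this, tsub_self]
      exact hq j s
    have hsupp : ∀ a, cf D (xe F i j) s a ≠ 0 → s = Sum.inr i ∧ a = (0, {j}) := by
      intro a ha
      obtain ⟨h1, h2, h3, -⟩ := cf_coeff_of_lower ht hD hq hx hb hlow ha
      obtain ⟨-, ⟨h4, -⟩ | ⟨-, l, rfl⟩⟩ := cf_coeff_weight hp ht le_rfl hD hq hx hb hlow ha
      · simpa using congrFun h4 i
      have hF : (1 : F) + 1 ≠ 0 := by
        have := natCast_ne_zero_of_lt F (p := p) two_ne_zero (by omega)
        rw [one_add_one_eq_two]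
        exact_mod_cast this
      have hwk : ∀ k, (if k ∈ a.2 then (1 : F) else 0) - (if k = l then 1 else 0) =
          (if k = j then 1 else 0) - if k = i then 1 else 0 := by
        intro k
        have := h2 k
        simp only [lam, wt, h1, Pi.zero_apply, Nat.cast_zero, sub_zero, reduceCtorEq, if_false,
          add_zero, Sum.inr.injEq, Finset.mem_singleton, eq_comm (a := l), Pi.single_apply] at this
        rw [this]
        split_ifs <;> simp
      -- At k = i the right side is -1, which only the ∂_{l'} term can supply, since 0 and 1 differ
      -- from -1 in F.
      have hl : l = i := by
        by_contra hne
        have h5 := hwk i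
        rw [if_neg (Ne.symm hne), if_neg hij, if_pos rfl, sub_zero, zero_sub] at h5
        split_ifs at h5
        · exact hF (by linear_combination h5)
        · simp at h5
      subst hl
      refine ⟨rfl, Prod.ext h1 (Finset.ext fun k => ?_)⟩
      have h5 := sub_left_injective (hwk k)
      rw [Finset.mem_singleton]
      by_cases h6 : k ∈ a.2 <;> by_cases h7 : k = j <;> simp [h6, h7] at h5 ⊢
      all_goals simp_all
    refine Finsupp.ext fun a => ?_
    by_cases ha : s = Sum.inr i ∧ a = (0, {j})
    · obtain ⟨rfl, rfl⟩ := ha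
      simp [q, var]
    · have h0 : cf D (xe F i j) s a = 0 := by
        by_contra h
        exact ha (hsupp a h)
      rw [h0]
      split_ifs with h
      · have h1 : (0, {j}) ≠ a := fun e => ha ⟨h, e.symm⟩
        simp [var, Finsupp.single_eq_of_ne' h1]
      · rfl
  -- Compare the ∂_{i'}-coefficients in D applied to the bracket of T_H(x_i x_{j'}) with T_H(x_j
  -- x_{k'}), which is -T_H(x_i x_{k'}) up to a torus element.
  have hcoc : ∀ i j k, q i j + q j k = q i k := by
    intro i j k
    rcases eq_or_ne i j with rfl | hij
    · rw [hqd, zero_add]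
    have h := cf_lie D (xe_mem_oddTrunc ht i j) (xe_mem_oddTrunc ht j k) (Sum.inr i)
    have h1 : cf D (TH F n (xe F i j) (xe F j k)) (Sum.inr i) = -(q i k • var (Sum.inr k)) := by
      rw [TH_xe_xe, sub_eq_add_neg, cf_add, ← neg_one_smul F (xe F i k), cf_smul, hcf i k]
      have : cf D (if k = i then xe F j j else 0) (Sum.inr i) = 0 := by
        split_ifs
        · exact hx j _
        · exact cf_zero D _
      rw [this]
      simp
    rw [h1, hcf j k, hcf i j, hc_xe, hc_xe] at h
    simp only [Sum.inr.injEq, hij, if_false, if_true, map_zero, reduceCtorEq, vf_var, map_smul,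
      TH_xe_var_inr, hcf j k] at h
    have h2 := DFunLike.congr_fun h (0, {k})
    simp only [var, zero_sub, sub_zero, Finsupp.neg_apply, Finsupp.sub_apply, Finsupp.smul_apply,
      Finsupp.single_eq_same, smul_eq_mul, mul_one] at h2
    linear_combination h2
  -- A base point trivializes the cocycle: q_{ij} = q_{0j} - q_{0i}.
  let b : Fin n → F := q ⟨0, hn⟩
  refine ⟨_, dg_mem_deg b, fun i s => ?_, fun i j s => ?_⟩
  · rw [cf_sub_dg b (var_mem_oddTrunc i), lie_dg_var, hq, sub_zero]
  · rw [cf_sub_dg b (xe_mem_oddTrunc ht i j), lie_dg_xe, hcf]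
    have : b j - b i = q i j := by
      have := hcoc ⟨0, hn⟩ i j
      linear_combination -this
    rw [this, sub_self]

/-- A derivation of degree zero that vanishes on `ℋ𝒪_{-1}` and on `ℋ𝒪_0` agrees with an inner one
on `ℋ𝒪_{-1}`, on `ℋ𝒪_0` and on a given `T_H(x^u)` with `|u| = 3`. -/
theorem exists_sub_adW_triple (hp : 5 ≤ p) (ht : ∀ i, 1 ≤ t i)
    (hD : D ∈ derDeg F p t 0) (hq : ∀ i s, cf D (var (Sum.inr i)) s = 0)
    (hx : ∀ i j s, cf D (xe F i j) s = 0) {u : Finset (Fin n)} (hu : #u = 3) :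
    ∃ E ∈ wittEvenDeg F p t 0,
      (∀ i s, cf (D - adW F p t E) (var (Sum.inr i)) s = 0) ∧
      (∀ i j s, cf (D - adW F p t E) (xe F i j) s = 0) ∧
      ∀ s, cf (D - adW F p t E) (Finsupp.single (0, u) 1) s = 0 := by
  have h2 : (2 : F) ≠ 0 := by
    exact_mod_cast natCast_ne_zero_of_lt F (p := p) two_ne_zero (by omega)
  have hodd : #u ≡ 1 [MOD 2] := by rw [hu]; rfl
  have hb : Adm p t (0, u) := adm_odd hodd
  have hxu := single_mem_oddTrunc (F := F) hb 1
  set X : DPS F n := Finsupp.single (0, u) 1 with hX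
  -- By weights, D(T_H(x^u)) has only the terms x^{u ∖ l} ∂_l that occur in T_H(x^u).
  have hsupp : ∀ s a, cf D X s a ≠ 0 → ∃ l, s = Sum.inl l ∧ l ∈ u ∧ a = (0, u.erase l) := by
    intro s a ha
    have hlow : ∀ k, (0 : Fin n → ℕ) k ≠ 0 → ∀ s,
        cf D (Finsupp.single ((0 : Fin n → ℕ) - Pi.single k 1, u) 1) s = 0 := by simp
    obtain ⟨h1, h3, -, -⟩ := cf_coeff_of_lower ht hD hq (fun i => hx i i) hb hlow ha
    obtain ⟨-, ⟨-, l, rfl⟩ | ⟨⟨j, h4⟩, -⟩⟩ :=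
      cf_coeff_weight hp ht le_rfl hD hq (fun i => hx i i) hb hlow ha
    swap
    · simpa using congrFun h4 j
    have hwk : ∀ k, (if k ∈ a.2 then (1 : F) else 0) + (if k = l then 1 else 0) =
        if k ∈ u then 1 else 0 := by
      intro k
      have := h3 k
      simpa only [lam, wt, h1, Pi.zero_apply, Nat.cast_zero, sub_zero, reduceCtorEq, if_false,
        Sum.inl.injEq, eq_comm (a := l)] using this
    have hl : l ∈ u ∧ l ∉ a.2 := by
      have := hwk l
      rw [if_pos rfl] at this
      by_cases h5 : l ∈ a.2 <;> by_cases h6 : l ∈ u <;> simp [h5, h6] at this ⊢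
      exact h2 (by linear_combination this)
    refine ⟨l, rfl, hl.1, Prod.ext h1 (Finset.ext fun k => ?_)⟩
    rw [Finset.mem_erase]
    rcases eq_or_ne k l with rfl | hk
    · simp [hl.2]
    · have := hwk k
      by_cases h5 : k ∈ a.2 <;> by_cases h6 : k ∈ u <;> simp [h5, h6, hk] at this ⊢
  obtain ⟨j, hj⟩ : u.Nonempty := Finset.card_pos.1 (by omega)
  obtain ⟨c, hc⟩ : ∃ c : F, cf D X (Sum.inl j) = c • pd F n (Sum.inr j) X := by
    refine ⟨cf D X (Sum.inl j) (0, u.erase j) * (wedgeSign {j} (u.erase j) : ℤ), ?_⟩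
    rw [hX, pd_odd_single, if_pos hj, ← hX, Finsupp.smul_single, smul_eq_mul, one_mul, mul_assoc]
    have h3 : ((wedgeSign {j} (u.erase j) : ℤ) : F) * (wedgeSign {j} (u.erase j) : ℤ) = 1 := by
      exact_mod_cast congrArg (Int.cast : ℤ → F) (wedgeSign_sq (Finset.notMem_erase j u))
    rw [h3, mul_one]
    refine Finsupp.ext fun a => ?_
    by_cases ha : (0, u.erase j) = a
    · rw [← ha, Finsupp.single_eq_same]
    · rw [Finsupp.single_eq_of_ne' ha]
      by_contra h
      obtain ⟨l, h4, -, h5⟩ := hsupp _ _ h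
      cases h4
      exact ha h5.symm
  have hall : ∀ l, cf D X (Sum.inl l) = c • pd F n (Sum.inr l) X := by
    intro l
    by_cases hl : l ∈ u
    swap
    · rw [hX, pd_odd_single, if_neg hl, smul_zero, ← hX]
      refine Finsupp.ext fun a => ?_
      by_contra h
      obtain ⟨k, h4, h5, -⟩ := hsupp _ _ h
      cases h4
      exact hl h5
    rcases eq_or_ne l j with rfl | hlj
    · exact hc
    -- T_H(x_l x_{j'}) commutes with T_H(x^u), as x_{j'} would occur twice. The ∂_j-coefficient of
    -- this relation ties the l-th scalar to the j-th.
    have h := cf_lie D (xe_mem_oddTrunc ht l j) hxu (Sum.inl j)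
    have hjl : j ∈ u.erase l := Finset.mem_erase.2 ⟨hlj.symm, hj⟩
    have h3 : TH F n (xe F l j) X = 0 := by
      rw [TH_xe, hX, odd_transvection_single, pd_even_single,
        wedgeSign_eq_zero (Finset.mem_singleton_self j) hjl]
      simp
    have h4 : TH F n (xe F l j) (pd F n (Sum.inr j) X) = -pd F n (Sum.inr l) X := by
      have h5 : mul F n (var (Sum.inr j)) (pd F n (Sum.inr j) (pd F n (Sum.inr l) X)) =
          pd F n (Sum.inr l) X := by
        rw [hX, pd_odd_single (k := l), if_pos hl, odd_euler_single, if_pos hjl]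
      have h6 : pd F n (Sum.inl j) (pd F n (Sum.inr j) X) = 0 := by
        rw [hX, pd_odd_single, if_pos hj, pd_even_single]
        exact if_pos rfl
      rw [TH_xe, h6, pd_comm, map_smul, h5]
      simp [par]
    rw [h3, cf_zero, hc, map_smul, h4, hx, map_zero, show cf D (xe F l j) = 0 from
      funext (hx l j), map_zero, LinearMap.zero_apply, hc_xe, if_pos rfl, map_neg, vf_var] at h
    simp only [smul_neg, sub_neg_eq_add, sub_zero] at h
    exact (neg_add_eq_zero.1 h.symm).symm
  -- Being constant, b does not disturb ℋ𝒪_0; the eigenvalue on x^{u ∖ l} adds up two entries, hence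
  -- the division by 2.
  let b : Fin n → F := fun _ => -(c / 2)
  refine ⟨_, dg_mem_deg b, fun i s => ?_, fun i j s => ?_, fun s => ?_⟩
  · rw [cf_sub_dg b (var_mem_oddTrunc i), lie_dg_var, hq, sub_zero]
  · rw [cf_sub_dg b (xe_mem_oddTrunc ht i j), lie_dg_xe, hx]
    simp [b]
  · rw [cf_sub_dg b hxu, hX, lie_dg_odd_single b hodd, ← hX]
    rcases s with l | l
    · rw [hall]
      simp only
      by_cases hl : l ∈ u
      · have : ∑ j ∈ u.erase l, b j = -c := by
          rw [Finset.sum_const, Finset.card_erase_of_mem hl, hu]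
          simp only [nsmul_eq_mul]
          push_cast
          field_simp
        rw [this, neg_neg, sub_self]
      · rw [hX, pd_odd_single, if_neg hl]
        simp
    · simp only [sub_zero]
      refine Finsupp.ext fun a => ?_
      by_contra h
      obtain ⟨k, h4, -⟩ := hsupp _ _ h
      cases h4

/-- The bracket with T_H(x_i x_{j'}) exchanges x_{i'} for x_{j'}. So any triple is reached from u,
one element at a time. -/
theorem cf_odd_eq_zero_of_triple (ht : ∀ i, 1 ≤ t i) (hx : ∀ i j s, cf D (xe F i j) s = 0)
    {u : Finset (Fin n)} (hu : #u = 3) (h0 : ∀ s, cf D (Finsupp.single (0, u) 1) s = 0)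
    {v : Finset (Fin n)} (hv : #v = 3) (s : Ind n) : cf D (Finsupp.single (0, v) 1) s = 0 := by
  induction hm : #(v \ u) using Nat.strong_induction_on generalizing v s with
  | _ m ih =>
    by_cases h : v ⊆ u
    · rw [Finset.eq_of_subset_of_card_le h (by omega)]
      exact h0 s
    obtain ⟨j, hj, hju⟩ := Finset.not_subset.1 h
    have h' : ¬ u ⊆ v := fun h' =>
      h (Finset.eq_of_subset_of_card_le h' (by omega)).ge
    obtain ⟨i, hi, hiv⟩ := Finset.not_subset.1 h'
    have hie : i ∉ v.erase j := fun h => hiv (Finset.mem_of_mem_erase h)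
    have hw : #(insert i (v.erase j)) = 3 := by
      rw [Finset.card_insert_of_notMem hie, Finset.card_erase_of_mem hj, hv]
    have hlt : #(insert i (v.erase j) \ u) < m := by
      rw [← hm, Finset.insert_sdiff_of_mem _ hi]
      refine Finset.card_lt_card ⟨Finset.sdiff_subset_sdiff (Finset.erase_subset j v) subset_rfl,
        fun hs => ?_⟩
      have := hs (Finset.mem_sdiff.2 ⟨hj, hju⟩)
      simp at this
    have hd : Disjoint {j} ((insert i (v.erase j)).erase i) := by
      rw [Finset.erase_insert hie]; simp
    obtain ⟨c, hc, hTH⟩ := TH_odd_single_eq (F := F) (a := (Pi.single i 1, {j}))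
      (w := insert i (v.erase j)) (i := i) rfl (Finset.mem_insert_self _ _) (by simp) hd
      fun k _ hki h => absurd (Pi.single_eq_of_ne hki 1) h
    have hres : ((Pi.single i 1 : Fin n → ℕ) - Pi.single i 1,
        {j} ∪ (insert i (v.erase j)).erase i) = (0, v) := by
      rw [tsub_self, Finset.erase_insert hie, ← Finset.insert_eq, Finset.insert_erase hj]
    rw [hres] at hTH
    exact cf_single_eq_zero (adm_single ht i (u := {j}) rfl) (adm_odd (by rw [hw]; rfl)) hc hTH (hx i j)
      (fun s => ih _ hlt hw s rfl) s

/-- For i ∈ u with i ≠ j, the bracket of x_i x_j x_{i'} with x^u is ± x_j x^u; differentiating by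
x_j instead would repeat x_{i'}. D kills the cubic monomial by weights, its exponent being neither 0
nor some ε_k. -/
theorem cf_mixed_eq_zero (hp : 5 ≤ p) (ht : ∀ i, 1 ≤ t i) (hD : D ∈ derDeg F p t 0)
    (hq : ∀ i s, cf D (var (Sum.inr i)) s = 0) (hx : ∀ i j s, cf D (xe F i j) s = 0)
    {u : Finset (Fin n)} (hu : 3 ≤ #u) (hodd : #u ≡ 1 [MOD 2])
    (h0 : ∀ s, cf D (Finsupp.single (0, u) 1) s = 0) (j : Fin n) (s : Ind n) :
    cf D (Finsupp.single (Pi.single j 1, u) 1) s = 0 := by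
  obtain ⟨i, hi, hij⟩ := Finset.exists_mem_ne (s := u) (by omega) j
  have hb : Adm p t (Pi.single i 1 + Pi.single j 1, {i}) := adm_single_add ht hij rfl
  have hquad : ∀ s, cf D (Finsupp.single (Pi.single i 1 + Pi.single j 1, {i}) 1) s = 0 := by
    intro s
    refine Finsupp.ext fun a => ?_
    by_contra h
    have hlow : ∀ k, (Pi.single i 1 + Pi.single j 1 : Fin n → ℕ) k ≠ 0 → ∀ s, cf D (Finsupp.single
        (Pi.single i 1 + Pi.single j 1 - Pi.single k 1, {i}) 1) s = 0 := by
      intro k hk s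
      rcases eq_or_ne k i with rfl | hki
      · rw [add_tsub_cancel_left]
        exact hx j k s
      · rcases eq_or_ne k j with rfl | hkj
        · rw [add_tsub_cancel_right]
          exact hx i i s
        · simp [hki, hkj] at hk
    obtain ⟨-, ⟨h1, -⟩ | ⟨⟨k, h1⟩, -⟩⟩ :=
      cf_coeff_weight hp ht le_rfl hD hq (fun i => hx i i) hb hlow h
    · have := congrFun h1 i
      simp at this
    · have h2 := congrFun h1 i
      have h3 := congrFun h1 j
      simp only [Pi.add_apply, Pi.single_eq_same, Pi.single_eq_of_ne hij,
        Pi.single_eq_of_ne hij.symm, Pi.single_apply] at h2 h3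
      split_ifs at h2 h3 with h4 h5
      · exact hij (h4.trans h5.symm)
  obtain ⟨c, hc, hTH⟩ := TH_odd_single_eq (F := F) (a := (Pi.single i 1 + Pi.single j 1, {i}))
    (w := u) (i := i) rfl hi (by simp) (by simp) fun k _ hki _ => by
      simpa using ⟨hki.symm, hi⟩
  have hres : ((Pi.single i 1 + Pi.single j 1 : Fin n → ℕ) - Pi.single i 1, {i} ∪ u.erase i) =
      (Pi.single j 1, u) := by
    rw [add_tsub_cancel_left, ← Finset.insert_eq, Finset.insert_erase hi]
  rw [hres] at hTH
  exact cf_single_eq_zero hb (adm_odd hodd) hc hTH hquad h0 s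

/-- For |u| ≥ 5 take a triple v ⊆ u and i ∈ v: the bracket of x_i x^v with x_{i'} x^{u ∖ v} is ±
x^u, and the second factor has two odd variables fewer than x^u. -/
theorem cf_odd_eq_zero (hp : 5 ≤ p) (ht : ∀ i, 1 ≤ t i) (hD : D ∈ derDeg F p t 0)
    (hq : ∀ i s, cf D (var (Sum.inr i)) s = 0) (hx : ∀ i j s, cf D (xe F i j) s = 0)
    (h3 : ∀ u : Finset (Fin n), #u = 3 → ∀ s, cf D (Finsupp.single (0, u) 1) s = 0)
    {u : Finset (Fin n)} (hodd : #u ≡ 1 [MOD 2]) (s : Ind n) :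
    cf D (Finsupp.single (0, u) 1) s = 0 := by
  induction hm : #u using Nat.strong_induction_on generalizing u s with
  | _ m ih =>
    have hodd' : #u % 2 = 1 := hodd
    rcases lt_or_ge #u 5 with h5 | h5
    · have : #u = 1 ∨ #u = 3 := by omega
      rcases this with h | h
      · obtain ⟨i, rfl⟩ := Finset.card_eq_one.1 h
        exact hq i s
      · exact h3 u h s
    obtain ⟨v, hvu, hv⟩ := Finset.exists_subset_card_eq (s := u) (n := 3) (by omega)
    obtain ⟨i, hi⟩ : v.Nonempty := Finset.card_pos.1 (by omega)
    have hi' : i ∉ u \ v := fun h => (Finset.mem_sdiff.1 h).2 hi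
    have hw : #(insert i (u \ v)) = m - 2 := by
      rw [Finset.card_insert_of_notMem hi', Finset.card_sdiff_of_subset hvu, hv]
      omega
    have hwodd : #(insert i (u \ v)) ≡ 1 [MOD 2] := by
      change _ % 2 = 1
      omega
    have hd : Disjoint v ((insert i (u \ v)).erase i) := by
      rw [Finset.erase_insert hi']; exact Finset.disjoint_sdiff
    have hvodd : #v ≡ 1 [MOD 2] := by rw [hv]; rfl
    obtain ⟨c, hc, hTH⟩ := TH_odd_single_eq (F := F) (a := (Pi.single i 1, v))
      (w := insert i (u \ v)) (i := i) hvodd (Finset.mem_insert_self _ _) (by simp) hd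
      fun k _ hki h => absurd (Pi.single_eq_of_ne hki 1) h
    have hres : ((Pi.single i 1 : Fin n → ℕ) - Pi.single i 1,
        v ∪ (insert i (u \ v)).erase i) = (0, u) := by
      rw [tsub_self, Finset.erase_insert hi', Finset.union_sdiff_of_subset hvu]
    rw [hres] at hTH
    exact cf_single_eq_zero (adm_single ht i hvodd) (adm_odd hwodd) hc hTH
      (cf_mixed_eq_zero hp ht hD hq hx (by omega) hvodd (h3 v hv) i)
      (fun s => ih (m - 2) (by omega) hwodd s hw) s

/-- A derivation of degree zero that vanishes on `ℋ𝒪_{-1}`, on `ℋ𝒪_0` and on some `T_H(x^u)` with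
`|u| = 3` is zero. -/
theorem eq_zero_of_triple (hp : 5 ≤ p) (ht : ∀ i, 1 ≤ t i) (hD : D ∈ derDeg F p t 0)
    (hq : ∀ i s, cf D (var (Sum.inr i)) s = 0) (hx : ∀ i j s, cf D (xe F i j) s = 0)
    {u : Finset (Fin n)} (hu : #u = 3) (h0 : ∀ s, cf D (Finsupp.single (0, u) 1) s = 0) :
    D = 0 := by
  have hall : ∀ v : Finset (Fin n), #v ≡ 1 [MOD 2] → ∀ s, cf D (Finsupp.single (0, v) 1) s = 0 :=
    fun v hv => cf_odd_eq_zero hp ht hD hq hx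
      (fun w hw => cf_odd_eq_zero_of_triple ht hx hu h0 hw) hv
  refine eq_zero_of_low hp ht le_rfl hD hq (fun i => hx i i) (fun _ => hall) fun _ j v hv s => ?_
  have hv' : #v % 2 = 1 := hv
  rcases lt_or_ge #v 3 with h | h
  · obtain ⟨i, rfl⟩ := Finset.card_eq_one.1 (show #v = 1 by omega)
    exact hx j i s
  · exact cf_mixed_eq_zero hp ht hD hq hx h hv (hall v hv) j s

end DegreeZero

end OddHamiltonian

end

/-! ### Assembly of the reductions -/

open OddHamiltonian in
theorem mainTheorem3 (F : Type*) [Field F] (p : ℕ) [Fact p.Prime] [CharP F p] (hp : 3 < p)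
    (n : ℕ) (hn : 3 ≤ n) (t : Fin n → ℕ) (ht : ∀ i, 1 ≤ t i) (d : ℤ) (hd : 0 ≤ d) :
    OddHamiltonian.derDeg F p t d =
      (OddHamiltonian.wittEvenDeg F p t d).map (OddHamiltonian.adW F p t) := by
  have hp5 : 5 ≤ p := by
    rcases Nat.lt_or_ge p 5 with h | h
    · obtain rfl : p = 4 := by omega
      exact absurd (Fact.out : Nat.Prime 4) (by norm_num)
    · exact h
  refine le_antisymm (fun D hD => ?_) ?_
  swap
  · rintro _ ⟨E, hE, rfl⟩
    exact adW_mem_derDeg hE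
  have reduce : ∀ {D : LieDerivation F (hoEven F p t) (wittEven F p t)} {E},
      E ∈ wittEvenDeg F p t d → D - adW F p t E ∈ (wittEvenDeg F p t d).map (adW F p t) →
      D ∈ (wittEvenDeg F p t d).map (adW F p t) := fun hE h =>
    (Submodule.sub_mem_iff_left _ (Submodule.mem_map_of_mem hE)).1 h
  obtain ⟨E, hE, hq⟩ := exists_sub_adW_var (by omega) hn ht hD
  refine reduce hE ?_
  have hD1 := sub_mem hD (adW_mem_derDeg hE)
  obtain ⟨E, hE, hq, hx⟩ := exists_sub_adW_torus (by omega) hn ht hD1 hq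
  refine reduce hE ?_
  have hD2 := sub_mem hD1 (adW_mem_derDeg hE)
  -- For d > 0 the weights already give zero; for d = 0 two more corrections are needed.
  rcases hd.eq_or_lt with rfl | hpos
  · obtain ⟨E, hE, hq, hx⟩ := exists_sub_adW_zero hp5 (by omega) ht hD2 hq hx
    refine reduce hE ?_
    have hD3 := sub_mem hD2 (adW_mem_derDeg hE)
    obtain ⟨u, -, hu⟩ := exists_triple hn ⟨0, by omega⟩
    obtain ⟨E, hE, hq, hx, h0⟩ := exists_sub_adW_triple hp5 ht hD3 hq hx hu
    refine reduce hE ?_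
    have hD4 := sub_mem hD3 (adW_mem_derDeg hE)
    rw [eq_zero_of_triple hp5 ht hD4 hq hx hu h0]
    exact zero_mem _
  · rw [eq_zero_of_low hp5 ht hd hD2 hq hx (fun h => absurd h hpos.ne')
      fun h => absurd h hpos.ne']
    exact zero_mem _
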